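/- Let $\mathbb F$ be a nonabelian free group of finite rank and let $g\ge 0$. Let $H_g=\langle a_1,b_1,\dots,a_g,b_g\rangle$ be the free group of rank $2g$ (the fundamental group of the orientable surface of genus $g$ with one boundary component), $\partial_g=[a_1,b_1]\cdots[a_g,b_g]$ and $P_g=\langle\partial_g\rangle$. A *genus $g$ representation* of $x\in\mathbb F$ is a homomorphism $h:H_g\to\mathbb F$ with $h(\partial_g)=x$. Two representations $h,h'$ of $x$ are related by a *fractional Dehn twist* if either - $H_g=A*_CB$ with $C$ cyclic and $\partial_g\in A$, and there is $z\in\mathbb F$ centralizing $h(C)$ such that $h'|_A=h|_A$ and $h'(b)=z\,h(b)\,z^{-1}$ for $b\in B$; or - $H_g=\langle A,t\mid t^{-1}ct=\phi(c),\ c\in C\rangle$ is an HNN extension, where $\phi:C\to C'$ is an isomorphism of subgroups of $A$, $C$ is cyclic and $\partial_g\in A$, and there is $z\in\mathbb F$ centralizing $h(C)$ such that $h'|_A=h|_A$ and $h'(t)=z\,h(t)$. (Degenerate splittings such as $H_g=H_g*_{P_g}P_g$ are allowed.) Let $\sim$ be the equivalence relation generated by fractional Dehn twists. A representation is *$\sim$-injective*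 if all representations equivalent to it are injective. It is *admissible* if it is injective and its image is a primitive subgroup of $\mathbb F$, i.e. one closed under taking roots. The *algebraic genus* of $x\in[\mathbb F,\mathbb F]$ is the smallest $n\ge0$ such that $x$ has a genus $n$ representation, and a genus $g$ representation of $x$ is *minimal* if $g$ is the algebraic genus of $x$. Let $\hat f_{\mathbb F}(g)$ be the supremum, over all $x$ of algebraic genus $g$, of the number of $\sim$-classes of minimal $\sim$-injective representations of $x$. Let $\hat f'_{\mathbb F}(g)$ be the supremum, over all $x$ of algebraic genus $g$, of the number of distinct subgroups $h(H_g)\le\mathbb F$, where $h$ runs over the minimal admissible representations of $x$. Let $N(H_g,P_g)\in\mathbb N\cup\{\infty\}$ be the smallest $N$ for which there is a finite set $\mathcal F$ of proper quotients of $H_g$ such that each homomorphism $P_g\to\mathbb F$ has at most $N$ $\sim$-classes of extensions to $H_g$ with the property that no element of the class factors through an element of $\mathcal F$. Then $$N(H_g,P_g)\ \ge\ \hat f_{\mathbb F}(g)\ \ge\ \hat f'_{\mathbb F}(g)\ \ge\ 2^g .$$ -/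

import Mathlib

namespace SurfaceRep

/-! ### The surface group and its boundary element -/

/-- The free group `H_g = ⟨a_1, b_1, …, a_g, b_g⟩` of rank `2g`, the fundamental group of the
orientable surface of genus `g` with one boundary component. The letter `(i, false)` is `a_i`
and `(i, true)` is `b_i`. -/
abbrev SurfaceGroup (g : ℕ) : Type := FreeGroup (Fin g × Bool)

/-- The generator `a_i`. -/
def genA {g : ℕ} (i : Fin g) : SurfaceGroup g := FreeGroup.of (i, false)

/-- The generator `b_i`. -/
def genB {g : ℕ} (i : Fin g) : SurfaceGroup g := FreeGroup.of (i, true)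

/-- The boundary element `∂_g = [a_1, b_1] ⋯ [a_g, b_g]`. -/
def boundary (g : ℕ) : SurfaceGroup g :=
  (List.ofFn fun i : Fin g => genA i * genB i * (genA i)⁻¹ * (genB i)⁻¹).prod

/-- The boundary subgroup `P_g = ⟨∂_g⟩`. -/
def boundarySubgroup (g : ℕ) : Subgroup (SurfaceGroup g) :=
  Subgroup.zpowers (boundary g)

/-! ### Internal splittings of a group -/

section Splittings

variable {H : Type*} [Group H]

/-- The two vertex groups of an amalgam, as a family. -/
def vertexGroup (A B : Subgroup H) : Bool → Subgroup H
  | false => A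
  | true => B

/-- `H = A *_C B`: the subgroup `C` lies in both `A` and `B`, and the canonical homomorphism from
the abstract amalgamated product to `H` is an isomorphism. -/
def IsAmalgam (A B C : Subgroup H) : Prop :=
  ∃ hC : ∀ i, C ≤ vertexGroup A B i,
    Function.Bijective
      (Monoid.PushoutI.lift (φ := fun i => Subgroup.inclusion (hC i))
        (fun i => (vertexGroup A B i).subtype) C.subtype (fun _ => rfl))

/-- The relation `t⁻¹ c t = φ(c)` in the form which Mathlib's HNN extensions ask for, with
stable letter `t⁻¹`. -/
theorem hnn_rel {A : Subgroup H} {C C' : Subgroup A} (φ : C ≃* C') (t : H)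
    (ht : ∀ c : C, t⁻¹ * ((c : A) : H) * t = ((φ c : A) : H)) (c : C) :
    t⁻¹ * A.subtype (c : A) = A.subtype (φ c : A) * t⁻¹ := by
  simp [← ht c]

/-- `H = A *_φ = ⟨A, t ∣ t⁻¹ c t = φ(c), c ∈ C⟩`: the relations hold in `H`, and the canonical
homomorphism from the abstract HNN extension to `H` is an isomorphism. Mathlib's stable letter
conjugates `c` to `φ c` from the left, so that it is sent to `t⁻¹`. -/
def IsHNN (A : Subgroup H) (C C' : Subgroup A) (φ : C ≃* C') (t : H) : Prop :=
  ∃ ht : ∀ c : C, t⁻¹ * ((c : A) : H) * t = ((φ c : A) : H),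
    Function.Bijective (HNNExtension.lift (φ := φ) A.subtype t⁻¹ (hnn_rel φ t ht))

end Splittings

/-! ### Fractional Dehn twists and the equivalence relation -/

section Twists

variable {F : Type*} [Group F] {g : ℕ}

/-- `h'` arises from `h` by a fractional Dehn twist along an amalgam `H_g = A *_C B` with `C`
cyclic and `∂_g ∈ A`: it agrees with `h` on `A`, and on `B` it is `h` followed by conjugation by
an element `z` that centralizes `h(C)`. -/
def AmalgamTwist (h h' : SurfaceGroup g →* F) : Prop :=
  ∃ A B C : Subgroup (SurfaceGroup g),
    IsAmalgam A B C ∧ IsCyclic C ∧ boundary g ∈ A ∧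
      ∃ z : F, (∀ c ∈ C, z * h c = h c * z) ∧
        (∀ a ∈ A, h' a = h a) ∧ ∀ b ∈ B, h' b = z * h b * z⁻¹

/-- `h'` arises from `h` by a fractional Dehn twist along an HNN splitting `H_g = A *_φ` with `C`
cyclic and `∂_g ∈ A`: it agrees with `h` on `A`, and `h'(t) = z h(t)` for an element `z` that
centralizes `h(C)`. -/
def HNNTwist (h h' : SurfaceGroup g →* F) : Prop :=
  ∃ (A : Subgroup (SurfaceGroup g)) (C C' : Subgroup A) (φ : C ≃* C') (t : SurfaceGroup g),
    IsHNN A C C' φ t ∧ IsCyclic C ∧ boundary g ∈ A ∧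
      ∃ z : F, (∀ c ∈ C, z * h (c : SurfaceGroup g) = h (c : SurfaceGroup g) * z) ∧
        (∀ a ∈ A, h' a = h a) ∧ h' t = z * h t

/-- `h` and `h'` are related by a fractional Dehn twist. -/
def FractionalDehnTwist (h h' : SurfaceGroup g →* F) : Prop :=
  AmalgamTwist h h' ∨ HNNTwist h h'

/-- The equivalence relation `∼` generated by fractional Dehn twists. -/
def twistSetoid (g : ℕ) (F : Type*) [Group F] : Setoid (SurfaceGroup g →* F) :=
  Relation.EqvGen.setoid FractionalDehnTwist

/-- Equivalent homomorphisms take the same value at `∂_g`, so that `∼` restricts, for every `x`,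
to the equivalence relation on the representations of `x` generated by fractional Dehn twists. -/
theorem twistSetoid_boundary {h h' : SurfaceGroup g →* F} (hh : twistSetoid g F h h') :
    h' (boundary g) = h (boundary g) := by
  change Relation.EqvGen FractionalDehnTwist h h' at hh
  induction hh with
  | rel x y hxy =>
    rcases hxy with ⟨A, B, C, -, -, hA, z, -, h1, -⟩ | ⟨A, C, C', φ, t, -, -, hA, z, -, h1, -⟩
    · exact h1 _ hA
    · exact h1 _ hA
  | refl x => rfl
  | symm x y _ ih => exact ih.symm
  | trans x y z _ _ ih1 ih2 => exact ih2.trans ih1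

end Twists

/-! ### Representations, minimality, `∼`-injectivity, admissibility -/

section Representations

variable {F : Type*} [Group F] {g : ℕ}

/-- `h` is a genus `g` representation of `x`. -/
def Represents (h : SurfaceGroup g →* F) (x : F) : Prop := h (boundary g) = x

/-- `x` has algebraic genus `g`: `g` is the smallest genus of a representation of `x`.
No `g` satisfies this if `x` is not in the commutator subgroup. -/
def HasAlgebraicGenus (x : F) (g : ℕ) : Prop :=
  IsLeast {n : ℕ | ∃ h : SurfaceGroup n →* F, Represents h x} g

/-- `h` is a minimal representation of `x`. -/
def IsMinimalRep (h : SurfaceGroup g →* F) (x : F) : Prop :=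
  Represents h x ∧ HasAlgebraicGenus x g

/-- `h` is `∼`-injective: every representation equivalent to it is injective. -/
def SimInjective (h : SurfaceGroup g →* F) : Prop :=
  ∀ h' : SurfaceGroup g →* F, twistSetoid g F h h' → Function.Injective h'

/-- A subgroup is primitive if it is closed under taking roots. -/
def IsPrimitiveSubgroup (S : Subgroup F) : Prop :=
  ∀ (y : F) (n : ℕ), n ≠ 0 → y ^ n ∈ S → y ∈ S

/-- `h` is admissible: injective with primitive image. -/
def IsAdmissible (h : SurfaceGroup g →* F) : Prop :=
  Function.Injective h ∧ IsPrimitiveSubgroup h.range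

/-- The number of equivalence classes of minimal `∼`-injective genus `g` representations
of `x`. -/
noncomputable def numMin (g : ℕ) (x : F) : ℕ∞ :=
  {c : Quotient (twistSetoid g F) |
    ∃ h : SurfaceGroup g →* F, IsMinimalRep h x ∧ SimInjective h ∧
      Quotient.mk (twistSetoid g F) h = c}.encard

/-- The number of images of minimal admissible genus `g` representations of `x`. -/
noncomputable def numMin' (g : ℕ) (x : F) : ℕ∞ :=
  {S : Subgroup F |
    ∃ h : SurfaceGroup g →* F, IsMinimalRep h x ∧ IsAdmissible h ∧ h.range = S}.encard

end Representations

/-- The supremum, over the elements `x` of algebraic genus `g`, of the number of equivalence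
classes of minimal `∼`-injective representations of `x`. -/
noncomputable def fHat (F : Type*) [Group F] (g : ℕ) : ℕ∞ :=
  ⨆ (x : F) (_ : HasAlgebraicGenus x g), numMin g x

/-- The supremum, over the elements `x` of algebraic genus `g`, of the number of images of
minimal admissible representations of `x`. -/
noncomputable def fHat' (F : Type*) [Group F] (g : ℕ) : ℕ∞ :=
  ⨆ (x : F) (_ : HasAlgebraicGenus x g), numMin' g x

/-! ### Sela's number -/

/-- A proper quotient `H → H ⧸ K` of a group `H`, given by its nontrivial kernel `K`. -/
structure ProperQuotient (H : Type*) [Group H] where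
  /-- The kernel of the quotient map. -/
  ker : Subgroup H
  normal : ker.Normal
  ne_bot : ker ≠ ⊥

attribute [instance] ProperQuotient.normal

/-- The homomorphism `h` factors through the quotient map `H → H ⧸ K`. -/
def FactorsThrough {H F : Type*} [Group H] [Group F] (h : H →* F) (q : ProperQuotient H) : Prop :=
  ∃ k : H ⧸ q.ker →* F, h = k.comp (QuotientGroup.mk' q.ker)

section Sela

variable {F : Type*} [Group F] {g : ℕ}

/-- `h` is solid with respect to the set `Q` of proper quotients: no homomorphism equivalent to
`h` factors through an element of `Q`. -/
def IsSolid (Q : Finset (ProperQuotient (SurfaceGroup g))) (h : SurfaceGroup g →* F) : Prop :=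
  ∀ h' : SurfaceGroup g →* F, twistSetoid g F h h' → ∀ q ∈ Q, ¬ FactorsThrough h' q

/-- The number of equivalence classes of extensions of `p : P_g → F` to `H_g` that are solid with
respect to `Q`. -/
noncomputable def numSolid (Q : Finset (ProperQuotient (SurfaceGroup g)))
    (p : boundarySubgroup g →* F) : ℕ∞ :=
  {c : Quotient (twistSetoid g F) |
    ∃ h : SurfaceGroup g →* F, h.comp (boundarySubgroup g).subtype = p ∧ IsSolid Q h ∧
      Quotient.mk (twistSetoid g F) h = c}.encard

end Sela

/-- `N` is a bound as in Sela's theorem for `(H_g, P_g)`: for some finite set `Q` of proper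
quotients of `H_g`, every homomorphism `P_g → F` has at most `N` equivalence classes of
extensions to `H_g` that are solid with respect to `Q`. -/
def IsSelaBound (F : Type*) [Group F] (g : ℕ) (N : ℕ∞) : Prop :=
  ∃ Q : Finset (ProperQuotient (SurfaceGroup g)),
    ∀ p : boundarySubgroup g →* F, numSolid Q p ≤ N

/-- Sela's number `N(H_g, P_g)`, the smallest bound. -/
noncomputable def selaNumber (F : Type*) [Group F] (g : ℕ) : ℕ∞ :=
  sInf {N : ℕ∞ | IsSelaBound F g N}

end SurfaceRep

namespace SurfaceRep

open Monoid (CoprodI)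

/-! ### `∼`-injective representations are solid for every finite set of proper quotients. -/

section SelaBound

variable {F : Type*} [Group F] {g : ℕ}

/-! The first inequality holds because an injective homomorphism factors through no proper quotient:
a `∼`-injective class is counted whatever finite set of quotients is chosen.

For the second, the image of an admissible representation is constant on its `∼`-class
(`IsAdmissible.of_twistSetoid`). Consider a twist by `z` along `C`. If `C` is nontrivial, a power of
`z` lies in `h(C)`, because commuting elements of a free group lie in a cyclic subgroup. Primitivity
then gives `z = h(y)`, and the twist is `h` precomposed with an automorphism of `H_g`. If `C` is
trivial, there is no HNN twist and an amalgam twist changes nothing, since `∂_g` lies in no proper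
free factor. This follows from nondegeneracy of the intersection form on characters, which is read
off from the value of `∂_g` in a Heisenberg group (`intersection_eq_zero`).

For the third, there are two pairs in the free group on `a, b` that have the same commutator but
generate different primitive subgroups. Choosing one of them in every handle gives `2^g` injective
endomorphisms `wedgeRep ε` of `H_g` with a common value at `∂_g` and distinct images. The images are
primitive because their core graphs have vertex orders that every edge label preserves, so that a
power of a word is a loop only if the word is. The common value has genus at least `g`: fewer than
`g` handles leave a nonzero character in the radical of a nondegenerate form.

To pass to an arbitrary nonabelian free group, `H_g` is embedded in `ℤ * ℤ`, a retract of that group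
(`exists_embedding`). The words used contain many distinct exponents of `a`. Quasi-homomorphisms
that detect a few well-chosen exponents turn a representation of the image of `y` into one of `y` of
the same genus, so the genus does not drop. A homomorphism to a wreath product that recovers the
original element keeps primitive subgroups primitive. -/

theorem not_factorsThrough_of_injective {H F : Type*} [Group H] [Group F] {h : H →* F}
    (hh : Function.Injective h) (q : ProperQuotient H) : ¬ FactorsThrough h q := by
  rintro ⟨k, rfl⟩
  refine q.ne_bot ((Subgroup.eq_bot_iff_forall _).2 fun x hx => hh ?_)
  have : (QuotientGroup.mk' q.ker) x = 1 := by simpa using hx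
  rw [MonoidHom.comp_apply, this, map_one, map_one]

theorem SimInjective.isSolid {h : SurfaceGroup g →* F} (hh : SimInjective h)
    (Q : Finset (ProperQuotient (SurfaceGroup g))) : IsSolid Q h :=
  fun h' hr q _ => not_factorsThrough_of_injective (hh h' hr) q

theorem comp_boundarySubgroup_subtype_eq {h h' : SurfaceGroup g →* F}
    (hh : h (boundary g) = h' (boundary g)) :
    h.comp (boundarySubgroup g).subtype = h'.comp (boundarySubgroup g).subtype := by
  ext ⟨x, hx⟩
  obtain ⟨n, rfl⟩ := Subgroup.mem_zpowers_iff.1 hx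
  simp [hh]

theorem fHat_le_selaNumber (F : Type*) [Group F] (g : ℕ) : fHat F g ≤ selaNumber F g := by
  refine le_sInf fun N ⟨Q, hQ⟩ => iSup₂_le fun x _ => ?_
  -- The bound is applied to the restriction of some representation `h₀` of `x` to `P_g`; all
  -- representations of `x` have this restriction. Without any, the count is zero.
  by_cases hex : ∃ h₀ : SurfaceGroup g →* F, Represents h₀ x
  · obtain ⟨h₀, h₀x⟩ := hex
    refine le_trans (Set.encard_le_encard ?_) (hQ (h₀.comp (boundarySubgroup g).subtype))
    rintro c ⟨h, hm, hs, rfl⟩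
    exact ⟨h, comp_boundarySubgroup_subtype_eq (hm.1.trans h₀x.symm), hs.isSolid Q, rfl⟩
  · have : numMin g x = 0 := by
      rw [numMin, Set.encard_eq_zero, Set.eq_empty_iff_forall_notMem]
      rintro c ⟨h, hm, -⟩
      exact hex ⟨h, hm.1⟩
    simp [this]

end SelaBound

/-! ### Commuting elements and roots in free groups -/

section Roots

instance isMulTorsionFree_of_isFreeGroup {F : Type*} [Group F] [IsFreeGroup F] :
    IsMulTorsionFree F :=
  (IsFreeGroup.toFreeGroup F).injective.isMulTorsionFree (IsFreeGroup.toFreeGroup F).toMonoidHom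

theorem subsingleton_of_freeGroup_commute {ι : Type*} (hc : ∀ x y : FreeGroup ι, x * y = y * x) :
    Subsingleton ι := by
  classical
  refine ⟨fun i j => by_contra fun hij => ?_⟩
  have := congrArg FreeGroup.toWord (hc (FreeGroup.of i) (FreeGroup.of j))
  simp [FreeGroup.toWord_mul, FreeGroup.reduce, hij] at this

theorem isCyclic_freeGroup_of_subsingleton {ι : Type*} [Subsingleton ι] :
    IsCyclic (FreeGroup ι) := by
  rcases isEmpty_or_nonempty ι with h | ⟨⟨i⟩⟩
  · infer_instance
  · refine ⟨⟨FreeGroup.of i, fun x => ?_⟩⟩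
    change x ∈ Subgroup.zpowers (FreeGroup.of i)
    induction x using FreeGroup.induction_on with
    | C1 => exact one_mem _
    | of j => rw [Subsingleton.elim j i]; exact Subgroup.mem_zpowers _
    | inv_of j h => exact inv_mem h
    | mul x y hx hy => exact mul_mem hx hy

theorem isCyclic_of_isFreeGroup_of_commute {G : Type*} [Group G] [IsFreeGroup G]
    (hc : ∀ x y : G, x * y = y * x) : IsCyclic G := by
  have hs : Subsingleton (IsFreeGroup.Generators G) := by
    refine subsingleton_of_freeGroup_commute fun x y => (IsFreeGroup.mulEquiv G).injective ?_
    simp [hc]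
  have := isCyclic_freeGroup_of_subsingleton (ι := IsFreeGroup.Generators G)
  exact isCyclic_of_surjective (IsFreeGroup.mulEquiv G) (IsFreeGroup.mulEquiv G).surjective

/-- The subgroup generated by `z` and `c` is free by Nielsen–Schreier and abelian, hence cyclic.
With `z = wⁱ` and `c = wʲ` one has `zʲ = cⁱ`, and `j ≠ 0`. -/
theorem exists_pow_mem_zpowers_of_commute {F : Type*} [Group F] [IsFreeGroup F] {z c : F}
    (hc : c ≠ 1) (h : z * c = c * z) : ∃ n : ℕ, n ≠ 0 ∧ z ^ n ∈ Subgroup.zpowers c := by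
  have hcomm : ∀ x ∈ ({z, c} : Set F), ∀ y ∈ ({z, c} : Set F), x * y = y * x := by
    rintro x (rfl | rfl) y (rfl | rfl) <;> first | rfl | exact h | exact h.symm
  let G := Subgroup.closure ({z, c} : Set F)
  have : IsCyclic G := by
    have := Subgroup.isMulCommutative_closure hcomm
    exact isCyclic_of_isFreeGroup_of_commute fun x y => mul_comm' x y
  obtain ⟨w, hw⟩ := this.exists_generator
  obtain ⟨i, hi⟩ := hw ⟨z, Subgroup.subset_closure (by simp)⟩
  obtain ⟨j, hj⟩ := hw ⟨c, Subgroup.subset_closure (by simp)⟩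
  have hi' : (w : F) ^ i = z := by simpa using congrArg Subtype.val hi
  have hj' : (w : F) ^ j = c := by simpa using congrArg Subtype.val hj
  have hj0 : j ≠ 0 := by rintro rfl; exact hc (by simpa using hj'.symm)
  refine ⟨j.natAbs, by simpa using hj0, ?_⟩
  have key : z ^ j ∈ Subgroup.zpowers c :=
    ⟨i, by simp only; rw [← hi', ← hj', ← zpow_mul, ← zpow_mul, mul_comm]⟩
  rcases Int.natAbs_eq j with h' | h' <;> rw [h'] at key
  · rwa [zpow_natCast] at key
  · rwa [zpow_neg, zpow_natCast, inv_mem_iff] at key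

theorem IsPrimitiveSubgroup.mem_of_commute {F : Type*} [Group F] [IsFreeGroup F] {S : Subgroup F}
    (hS : IsPrimitiveSubgroup S) {z c : F} (hc : c ≠ 1) (hcS : c ∈ S) (h : z * c = c * z) :
    z ∈ S := by
  obtain ⟨n, hn, hz⟩ := exists_pow_mem_zpowers_of_commute hc h
  exact hS z n hn ((Subgroup.zpowers_le.2 hcS) hz)

/-- Some positive power of `y` lies in `⟨c⟩` and is therefore fixed; roots in a free group are
unique. -/
theorem fixed_of_commute {H : Type*} [Group H] [IsFreeGroup H] {α : H →* H} {y c : H}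
    (hc : c ≠ 1) (hα : α c = c) (h : y * c = c * y) : α y = y := by
  obtain ⟨n, hn, k, hk⟩ := exists_pow_mem_zpowers_of_commute hc h
  refine pow_left_injective hn ?_
  simp only at hk ⊢
  rw [← map_pow, ← hk, map_zpow, hα]

theorem exists_hom_ne_one_of_isFreeGroup {G : Type*} [Group G] [IsFreeGroup G] [Nontrivial G] :
    ∃ f : G →* Multiplicative ℚ, f ≠ 1 := by
  have : Nonempty (IsFreeGroup.Generators G) := by
    by_contra hne
    rw [not_nonempty_iff] at hne
    exact not_subsingleton G (IsFreeGroup.mulEquiv G).symm.toEquiv.subsingleton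
  obtain ⟨i⟩ := this
  refine ⟨IsFreeGroup.lift fun _ => Multiplicative.ofAdd 1, fun h => ?_⟩
  have := DFunLike.congr_fun h (IsFreeGroup.of i)
  simp at this

end Roots

/-! ### The Heisenberg group and the intersection form -/

/-- The rational Heisenberg group. -/
@[ext]
structure Heisenberg where
  /-- The first coordinate. -/
  x : ℚ
  /-- The second coordinate. -/
  y : ℚ
  /-- The central coordinate. -/
  z : ℚ

namespace Heisenberg

instance : Mul Heisenberg := ⟨fun a b => ⟨a.x + b.x, a.y + b.y, a.z + b.z + a.x * b.y⟩⟩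
instance : One Heisenberg := ⟨⟨0, 0, 0⟩⟩
instance : Inv Heisenberg := ⟨fun a => ⟨-a.x, -a.y, -a.z + a.x * a.y⟩⟩

@[simp] theorem mul_x (a b : Heisenberg) : (a * b).x = a.x + b.x := rfl
@[simp] theorem mul_y (a b : Heisenberg) : (a * b).y = a.y + b.y := rfl
@[simp] theorem mul_z (a b : Heisenberg) : (a * b).z = a.z + b.z + a.x * b.y := rfl
@[simp] theorem one_x : (1 : Heisenberg).x = 0 := rfl
@[simp] theorem one_y : (1 : Heisenberg).y = 0 := rfl
@[simp] theorem one_z : (1 : Heisenberg).z = 0 := rfl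
@[simp] theorem inv_x (a : Heisenberg) : (a⁻¹).x = -a.x := rfl
@[simp] theorem inv_y (a : Heisenberg) : (a⁻¹).y = -a.y := rfl
@[simp] theorem inv_z (a : Heisenberg) : (a⁻¹).z = -a.z + a.x * a.y := rfl

instance : Group Heisenberg where
  mul_assoc a b c := by ext <;> simp <;> ring
  one_mul a := by ext <;> simp
  mul_one a := by ext <;> simp
  inv_mul_cancel a := by ext <;> simp

/-- The first coordinate as a homomorphism. -/
def xHom : Heisenberg →* Multiplicative ℚ where
  toFun a := Multiplicative.ofAdd a.x
  map_one' := rfl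
  map_mul' _ _ := rfl

/-- The second coordinate as a homomorphism. -/
def yHom : Heisenberg →* Multiplicative ℚ where
  toFun a := Multiplicative.ofAdd a.y
  map_one' := rfl
  map_mul' _ _ := rfl

/-- The inclusion of the center. -/
def central : Multiplicative ℚ →* Heisenberg where
  toFun c := ⟨0, 0, c.toAdd⟩
  map_one' := rfl
  map_mul' a b := by ext <;> simp

theorem commutator_eq (a b : Heisenberg) :
    a * b * a⁻¹ * b⁻¹ = central (Multiplicative.ofAdd (a.x * b.y - b.x * a.y)) := by
  ext <;> (simp [central]; try ring)

end Heisenberg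

theorem map_boundary {G : Type*} [Group G] {g : ℕ} (h : SurfaceGroup g →* G) :
    h (boundary g) = (List.ofFn fun i : Fin g =>
      h (genA i) * h (genB i) * (h (genA i))⁻¹ * (h (genB i))⁻¹).prod := by
  simp [boundary, map_list_prod, List.map_ofFn, Function.comp_def]

/-- Commutators are central in the Heisenberg group, so their contributions to `∂_g` add up to the
symplectic form of the two coordinate characters. -/
theorem heisenberg_boundary {g : ℕ} (h : SurfaceGroup g →* Heisenberg) :
    h (boundary g) = Heisenberg.central (Multiplicative.ofAdd
      (∑ i, ((h (genA i)).x * (h (genB i)).y - (h (genB i)).x * (h (genA i)).y))) := by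
  simp_rw [map_boundary, Heisenberg.commutator_eq]
  rw [ofAdd_sum, ← List.prod_ofFn, map_list_prod, List.map_ofFn]
  rfl

/-- Two rational characters of a free group are the first two coordinates of a homomorphism to the
Heisenberg group. -/
theorem exists_heisenberg_lift {X : Type*} (f f' : FreeGroup X →* Multiplicative ℚ) :
    ∃ Ψ : FreeGroup X →* Heisenberg,
      (∀ w, (Ψ w).x = (f w).toAdd) ∧ ∀ w, (Ψ w).y = (f' w).toAdd := by
  let Ψ : FreeGroup X →* Heisenberg := FreeGroup.lift fun i =>
    ⟨(f (FreeGroup.of i)).toAdd, (f' (FreeGroup.of i)).toAdd, 0⟩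
  have h1 : Heisenberg.xHom.comp Ψ = f := by ext; simp [Ψ, Heisenberg.xHom]
  have h2 : Heisenberg.yHom.comp Ψ = f' := by ext; simp [Ψ, Heisenberg.yHom]
  exact ⟨Ψ, fun w => congrArg Multiplicative.toAdd (DFunLike.congr_fun h1 w),
    fun w => congrArg Multiplicative.toAdd (DFunLike.congr_fun h2 w)⟩

/-- A character that vanishes on the image of some representation of `x = h(∂_g)` lies in the
radical of the intersection form of `h`. -/
theorem intersection_eq_zero {X : Type*} {n g : ℕ} (θ : SurfaceGroup n →* FreeGroup X)
    (h : SurfaceGroup g →* FreeGroup X) (hθ : θ (boundary n) = h (boundary g))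
    (f f' : FreeGroup X →* Multiplicative ℚ) (hf : f.comp θ = 1) :
    ∑ i, ((f (h (genA i))).toAdd * (f' (h (genB i))).toAdd -
      (f (h (genB i))).toAdd * (f' (h (genA i))).toAdd) = 0 := by
  obtain ⟨Ψ, hx, hy⟩ := exists_heisenberg_lift f f'
  have h0 : ∀ w, (f (θ w)).toAdd = 0 := fun w =>
    congrArg Multiplicative.toAdd (DFunLike.congr_fun hf w)
  have e1 := heisenberg_boundary (Ψ.comp θ)
  have e2 := heisenberg_boundary (Ψ.comp h)
  simp only [MonoidHom.comp_apply, hx, hy, h0, zero_mul, sub_zero, Finset.sum_const_zero] at e1 e2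
  rw [hθ, e2] at e1
  simpa [Heisenberg.central] using congrArg Heisenberg.z e1

theorem SurfaceGroup.character_eq_one_of_gens {g : ℕ} {f : SurfaceGroup g →* Multiplicative ℚ}
    (hA : ∀ i, f (genA i) = 1) (hB : ∀ i, f (genB i) = 1) : f = 1 := by
  ext ⟨i, s⟩
  cases s
  · simpa [genA] using hA i
  · simpa [genB] using hB i

/-- The intersection form is nondegenerate. -/
theorem character_eq_one_of_comp_eq_one {n g : ℕ} (θ : SurfaceGroup n →* SurfaceGroup g)
    (hθ : θ (boundary n) = boundary g) (f : SurfaceGroup g →* Multiplicative ℚ)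
    (hf : f.comp θ = 1) : f = 1 := by
  have key := fun f' => intersection_eq_zero θ (MonoidHom.id _) hθ f f' hf
  refine SurfaceGroup.character_eq_one_of_gens (fun i => ?_) fun i => ?_
  -- Pairing with the character dual to `b_i` isolates `f(a_i)`; the one dual to `a_i` isolates
  -- `f(b_i)` below.
  · have := key (FreeGroup.lift fun x => Multiplicative.ofAdd (if x = (i, true) then 1 else 0))
    simpa [genA, genB] using this
  · have := key (FreeGroup.lift fun x => Multiplicative.ofAdd (if x = (i, false) then 1 else 0))
    simpa [genA, genB] using this

/-! ### Vanishing characters of small free groups -/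

/-- The rational characters of a free group as a linear function of their values on the basis. -/
noncomputable def characterEval {X : Type*} (w : FreeGroup X) : (X → ℚ) →ₗ[ℚ] ℚ where
  toFun f := (FreeGroup.lift (fun i => Multiplicative.ofAdd (f i)) w).toAdd
  map_add' f f' := by
    have : FreeGroup.lift (fun i => Multiplicative.ofAdd ((f + f') i)) =
        FreeGroup.lift (fun i => Multiplicative.ofAdd (f i)) *
          FreeGroup.lift (fun i => Multiplicative.ofAdd (f' i)) := by
      ext; simp
    rw [this]; rfl
  map_smul' c f := by
    have : FreeGroup.lift (fun i => Multiplicative.ofAdd ((c • f) i)) =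
        (AddMonoidHom.toMultiplicative (AddMonoidHom.mulLeft c)).comp
          (FreeGroup.lift (fun i => Multiplicative.ofAdd (f i))) := by
      ext; simp
    rw [this]; rfl

/-- Pulling characters back along `θ` is a linear map from dimension `card X` to the smaller
dimension `card Y`, so it has a kernel. -/
theorem exists_character_ne_one_comp_eq_one {X Y : Type*} [Fintype X] [Fintype Y]
    (hc : Fintype.card Y < Fintype.card X) (θ : FreeGroup Y →* FreeGroup X) :
    ∃ f : FreeGroup X →* Multiplicative ℚ, f ≠ 1 ∧ f.comp θ = 1 := by
  let L : (X → ℚ) →ₗ[ℚ] (Y → ℚ) := LinearMap.pi fun j => characterEval (θ (FreeGroup.of j))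
  obtain ⟨v, hv, hv0⟩ := (Submodule.ne_bot_iff _).1
    (LinearMap.ker_ne_bot_of_finrank_lt (f := L) (by simpa using hc))
  refine ⟨FreeGroup.lift fun i => Multiplicative.ofAdd (v i), fun h => hv0 ?_, ?_⟩
  · ext i
    simpa using DFunLike.congr_fun h (FreeGroup.of i)
  · ext j
    exact congrFun (LinearMap.mem_ker.1 hv) j

/-! ### Universal properties of the splittings -/

section UniversalProperties

variable {H G : Type*} [Group H] [Group G]

theorem amalgam_lift_of {A B C : Subgroup H} (hC : ∀ i, C ≤ vertexGroup A B i) (i : Bool)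
    (x : vertexGroup A B i) :
    Monoid.PushoutI.lift (φ := fun i => Subgroup.inclusion (hC i))
      (fun i => (vertexGroup A B i).subtype) C.subtype (fun _ => rfl) (Monoid.PushoutI.of i x) =
      (x : H) :=
  Monoid.PushoutI.lift_of (φ := fun i => Subgroup.inclusion (hC i))
    (fun i => (vertexGroup A B i).subtype) C.subtype (fun _ => rfl) x

theorem hnn_lift_of {A : Subgroup H} {C C' : Subgroup A} {φ : C ≃* C'} {t : H}
    (ht : ∀ c : C, t⁻¹ * ((c : A) : H) * t = ((φ c : A) : H)) (a : A) :
    HNNExtension.lift (φ := φ) A.subtype t⁻¹ (hnn_rel φ t ht) (HNNExtension.of a) = (a : H) :=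
  HNNExtension.lift_of _ _ _ _

theorem IsAmalgam.exists_hom {A B C : Subgroup H} (h : IsAmalgam A B C) (α : A →* G) (β : B →* G)
    (hαβ : ∀ x (hA : x ∈ A) (hB : x ∈ B), x ∈ C → α ⟨x, hA⟩ = β ⟨x, hB⟩) :
    ∃ f : H →* G, (∀ a : A, f a = α a) ∧ ∀ b : B, f b = β b := by
  obtain ⟨hC, hbij⟩ := h
  let E := MulEquiv.ofBijective _ hbij
  let γ : ∀ i, vertexGroup A B i →* G := fun i => match i with
    | false => α
    | true => β
  let L : Monoid.PushoutI (fun i => Subgroup.inclusion (hC i)) →* G :=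
    Monoid.PushoutI.lift γ (α.comp (Subgroup.inclusion (hC false))) (by
      rintro (_ | _)
      · rfl
      · ext ⟨c, hc⟩
        exact (hαβ c (hC false hc) (hC true hc) hc).symm)
  have hE : ∀ i (x : vertexGroup A B i), L (E.symm x) = γ i x := by
    intro i x
    have : E.symm (x : H) =
        Monoid.PushoutI.of (φ := fun i => Subgroup.inclusion (hC i)) i x := by
      rw [MulEquiv.symm_apply_eq]
      exact (amalgam_lift_of hC i x).symm
    rw [this]
    exact Monoid.PushoutI.lift_of _ _ _ _
  exact ⟨L.comp E.symm.toMonoidHom, fun a => hE false a, fun b => hE true b⟩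

theorem IsAmalgam.hom_ext {A B C : Subgroup H} (h : IsAmalgam A B C) {f f' : H →* G}
    (hA : ∀ a ∈ A, f a = f' a) (hB : ∀ b ∈ B, f b = f' b) : f = f' := by
  obtain ⟨hC, hbij⟩ := h
  have : f.comp (Monoid.PushoutI.lift (φ := fun i => Subgroup.inclusion (hC i))
      (fun i => (vertexGroup A B i).subtype) C.subtype (fun _ => rfl)) =
      f'.comp (Monoid.PushoutI.lift (φ := fun i => Subgroup.inclusion (hC i))
      (fun i => (vertexGroup A B i).subtype) C.subtype (fun _ => rfl)) := by
    refine Monoid.PushoutI.hom_ext_nonempty fun i => ?_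
    ext x
    refine (congrArg f (amalgam_lift_of hC i x)).trans
      (Eq.trans ?_ (congrArg f' (amalgam_lift_of hC i x)).symm)
    cases i
    · exact hA x x.2
    · exact hB x x.2
  ext y
  obtain ⟨x, rfl⟩ := hbij.2 y
  exact DFunLike.congr_fun this x

theorem IsHNN.exists_hom {A : Subgroup H} {C C' : Subgroup A} {φ : C ≃* C'} {t : H}
    (h : IsHNN A C C' φ t) (α : A →* G) (s : G)
    (hs : ∀ c : C, s⁻¹ * α c * s = α (φ c)) :
    ∃ f : H →* G, (∀ a : A, f a = α a) ∧ f t = s := by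
  obtain ⟨ht, hbij⟩ := h
  let E := MulEquiv.ofBijective _ hbij
  let L : HNNExtension A C C' φ →* G := HNNExtension.lift α s⁻¹ (fun c => by simp [← hs c])
  refine ⟨L.comp E.symm.toMonoidHom, fun a => ?_, ?_⟩
  · have : E.symm (a : H) = HNNExtension.of a := by
      rw [MulEquiv.symm_apply_eq]
      exact (hnn_lift_of ht a).symm
    simp [this, L]
  · have : E.symm t = HNNExtension.t⁻¹ := by
      rw [MulEquiv.symm_apply_eq, map_inv]
      exact (inv_eq_iff_eq_inv.2 (HNNExtension.lift_t A.subtype t⁻¹ (hnn_rel φ t ht))).symm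
    simp [this, L]

theorem IsHNN.hom_ext {A : Subgroup H} {C C' : Subgroup A} {φ : C ≃* C'} {t : H}
    (h : IsHNN A C C' φ t) {f f' : H →* G} (hA : ∀ a ∈ A, f a = f' a) (ht : f t = f' t) :
    f = f' := by
  obtain ⟨hr, hbij⟩ := h
  have : f.comp (HNNExtension.lift (φ := φ) A.subtype t⁻¹ (hnn_rel φ t hr)) =
      f'.comp (HNNExtension.lift (φ := φ) A.subtype t⁻¹ (hnn_rel φ t hr)) := by
    refine HNNExtension.hom_ext ?_ ?_
    · ext a
      simpa using hA a a.2
    · simpa using ht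
  ext y
  obtain ⟨x, rfl⟩ := hbij.2 y
  exact DFunLike.congr_fun this x

end UniversalProperties

section Twists

variable {F : Type*} [Group F] {g : ℕ}

/-! ### Twists are symmetric -/

theorem AmalgamTwist.symm {h h' : SurfaceGroup g →* F} (ht : AmalgamTwist h h') :
    AmalgamTwist h' h := by
  obtain ⟨A, B, C, hs, hc, hA, z, hz, h1, h2⟩ := ht
  have hCA : C ≤ A := hs.1 false
  refine ⟨A, B, C, hs, hc, hA, z⁻¹, fun c hcC => ?_, fun a ha => (h1 a ha).symm, fun b hb => ?_⟩
  · rw [h1 c (hCA hcC), inv_mul_eq_iff_eq_mul, ← mul_assoc, hz c hcC, mul_inv_cancel_right]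
  · rw [h2 b hb]; group

theorem HNNTwist.symm {h h' : SurfaceGroup g →* F} (ht : HNNTwist h h') : HNNTwist h' h := by
  obtain ⟨A, C, C', φ, t, hs, hc, hA, z, hz, h1, h2⟩ := ht
  refine ⟨A, C, C', φ, t, hs, hc, hA, z⁻¹, fun c hcC => ?_, fun a ha => (h1 a ha).symm, ?_⟩
  · rw [h1 c c.2, inv_mul_eq_iff_eq_mul, ← mul_assoc, hz c hcC, mul_inv_cancel_right]
  · rw [h2]; group

theorem FractionalDehnTwist.symm {h h' : SurfaceGroup g →* F} (ht : FractionalDehnTwist h h') :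
    FractionalDehnTwist h' h :=
  ht.imp AmalgamTwist.symm HNNTwist.symm

/-! ### The boundary lies in no proper free factor -/

/-- The retraction `ρ` onto `A` that kills `B` fixes `∂_g`. A character that is trivial on `A` and
nontrivial on `B` dies under composition with `ρ`, against nondegeneracy of the intersection form.
-/
theorem IsAmalgam.right_eq_bot {A B : Subgroup (SurfaceGroup g)} (h : IsAmalgam A B ⊥)
    (hA : boundary g ∈ A) : B = ⊥ := by
  by_contra hB
  have : Nontrivial B := (Subgroup.nontrivial_iff_ne_bot B).2 hB
  obtain ⟨β, hβ⟩ := exists_hom_ne_one_of_isFreeGroup (G := B)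
  obtain ⟨f, hfA, hfB⟩ := h.exists_hom 1 β (by
    intro x h1 h2 hx
    obtain rfl := Subgroup.mem_bot.1 hx
    exact (map_one β).symm)
  obtain ⟨ρ, hρA, hρB⟩ := h.exists_hom A.subtype (1 : B →* SurfaceGroup g) (by
    intro x h1 h2 hx
    exact Subgroup.mem_bot.1 hx)
  have hf : f = 1 := by
    refine character_eq_one_of_comp_eq_one ρ (hρA ⟨_, hA⟩) f
      (h.hom_ext (fun a ha => ?_) fun b hb => ?_)
    · simpa [hρA ⟨a, ha⟩] using hfA ⟨a, ha⟩
    · simp [hρB ⟨b, hb⟩]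
  refine hβ (MonoidHom.ext fun b => ?_)
  rw [← hfB b, hf]; rfl

/-- With `C` trivial, `t` would span a free factor complementary to `A`. The retraction that kills
`t` fixes `∂_g` and annihilates the character that is trivial on `A` and nonzero at `t`. -/
theorem IsHNN.ne_bot {A : Subgroup (SurfaceGroup g)} {C C' : Subgroup A} {φ : C ≃* C'}
    {t : SurfaceGroup g} (h : IsHNN A C C' φ t) (hA : boundary g ∈ A) : C ≠ ⊥ := by
  rintro rfl
  have h1 : ∀ c : (⊥ : Subgroup A), (c : A) = 1 ∧ (φ c : A) = 1 := fun c => by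
    obtain rfl : c = 1 := Subsingleton.elim _ _
    simp
  obtain ⟨f, hfA, hft⟩ := h.exists_hom (1 : A →* Multiplicative ℚ) (Multiplicative.ofAdd 1)
    (fun c => by simp)
  obtain ⟨ρ, hρA, hρt⟩ := h.exists_hom A.subtype (1 : SurfaceGroup g)
    (fun c => by simp [(h1 c).1, (h1 c).2])
  have hf : f = 1 := by
    refine character_eq_one_of_comp_eq_one ρ (hρA ⟨_, hA⟩) f (h.hom_ext (fun a ha => ?_) ?_)
    · simpa [hρA ⟨a, ha⟩] using hfA ⟨a, ha⟩
    · simp [hρt]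
  rw [hf] at hft
  exact one_ne_zero (congrArg Multiplicative.toAdd hft).symm

/-! ### Twists of admissible representations -/

theorem bijective_of_comp_eq_id {H : Type*} [Group H] {α β : H →* H}
    (h1 : α.comp β = MonoidHom.id H) (h2 : β.comp α = MonoidHom.id H) : Function.Bijective α :=
  ⟨Function.LeftInverse.injective (DFunLike.congr_fun h2),
    Function.RightInverse.surjective (DFunLike.congr_fun h1)⟩

theorem IsAdmissible.comp_of_bijective {h : SurfaceGroup g →* F} (hh : IsAdmissible h)
    {α : SurfaceGroup g →* SurfaceGroup g} (hα : Function.Bijective α) :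
    IsAdmissible (h.comp α) ∧ (h.comp α).range = h.range := by
  have hr : (h.comp α).range = h.range := by
    rw [MonoidHom.range_comp, MonoidHom.range_eq_top.2 hα.2, ← MonoidHom.range_eq_map]
  refine ⟨⟨hh.1.comp hα.1, ?_⟩, hr⟩
  rw [hr]
  exact hh.2

variable [IsFreeGroup F]

/-- Primitivity puts `z` into the image, since it commutes with some `h(c) ≠ 1`. Injectivity carries
the commutation relations back to `H_g`. -/
theorem IsAdmissible.exists_preimage {h : SurfaceGroup g →* F} (hh : IsAdmissible h)
    {C : Subgroup (SurfaceGroup g)} (hC : C ≠ ⊥) {z : F} (hz : ∀ c ∈ C, z * h c = h c * z) :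
    ∃ y, h y = z ∧ ∀ c ∈ C, y * c = c * y := by
  obtain ⟨⟨c, hcC⟩, hc⟩ := Subgroup.ne_bot_iff_exists_ne_one.1 hC
  replace hc : c ≠ 1 := fun h1 => hc (Subtype.ext h1)
  have hc' : h c ≠ 1 := fun h1 => hc (hh.1 (by simpa using h1))
  obtain ⟨y, rfl⟩ := hh.2.mem_of_commute hc' ⟨_, rfl⟩ (hz c hcC)
  exact ⟨y, rfl, fun d hd => hh.1 (by simpa using hz d hd)⟩

/-- The twisting element is `h(y)`, so the twist is `h` precomposed with the automorphism that is
the identity on `A` and conjugation by `y` on `B`. Neither image nor injectivity is affected. -/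
theorem AmalgamTwist.admissible {h h' : SurfaceGroup g →* F} (ht : AmalgamTwist h h')
    (hh : IsAdmissible h) : IsAdmissible h' ∧ h'.range = h.range := by
  obtain ⟨A, B, C, hs, -, hA, z, hz, h1, h2⟩ := ht
  have hCA : C ≤ A := hs.1 false
  by_cases hC : C = ⊥
  · subst hC
    have hB := hs.right_eq_bot hA
    have : h' = h := hs.hom_ext h1 fun b hb => by
      rw [hB, Subgroup.mem_bot] at hb
      simp [hb]
    subst this
    exact ⟨hh, rfl⟩
  obtain ⟨y, rfl, hy⟩ := hh.exists_preimage hC hz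
  obtain ⟨⟨c, hcC⟩, hc⟩ := Subgroup.ne_bot_iff_exists_ne_one.1 hC
  have hc1 : c ≠ 1 := fun h1 => hc (Subtype.ext h1)
  have twist : ∀ w : SurfaceGroup g, (∀ c ∈ C, w * c = c * w) →
      ∃ α : SurfaceGroup g →* SurfaceGroup g, (∀ a ∈ A, α a = a) ∧
        ∀ b ∈ B, α b = w * b * w⁻¹ := by
    intro w hw
    obtain ⟨α, hα, hβ⟩ := hs.exists_hom A.subtype
      ((MulAut.conj w).toMonoidHom.comp B.subtype) (by
        intro x _ _ hx
        simp [hw x hx])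
    exact ⟨α, fun a ha => hα ⟨a, ha⟩, fun b hb => by simpa using hβ ⟨b, hb⟩⟩
  obtain ⟨α, hαA, hαB⟩ := twist y hy
  have hy' : ∀ c ∈ C, y⁻¹ * c = c * y⁻¹ := fun c hc => by
    rw [inv_mul_eq_iff_eq_mul, ← mul_assoc, hy c hc, mul_inv_cancel_right]
  obtain ⟨β, hβA, hβB⟩ := twist y⁻¹ hy'
  -- Only because `α` and `β` fix `y` are the twists by `y` and by `y⁻¹` inverse to each other.
  have hαy : α y = y := fixed_of_commute hc1 (hαA c (hCA hcC)) (hy c hcC)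
  have hβy : β y = y := fixed_of_commute hc1 (hβA c (hCA hcC)) (hy c hcC)
  have hbij : Function.Bijective α := by
    refine bijective_of_comp_eq_id (β := β) (hs.hom_ext ?_ ?_) (hs.hom_ext ?_ ?_)
    · intro a ha; simp [hαA a ha, hβA a ha]
    · intro b hb; simp [hαB b hb, hβB b hb, hαy, mul_assoc]
    · intro a ha; simp [hαA a ha, hβA a ha]
    · intro b hb; simp [hαB b hb, hβB b hb, hβy, mul_assoc]
  have : h' = h.comp α := hs.hom_ext (fun a ha => by simp [h1 a ha, hαA a ha])
    fun b hb => by simp [h2 b hb, hαB b hb]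
  rw [this]
  exact hh.comp_of_bijective hbij

theorem HNNTwist.admissible {h h' : SurfaceGroup g →* F} (ht : HNNTwist h h')
    (hh : IsAdmissible h) : IsAdmissible h' ∧ h'.range = h.range := by
  obtain ⟨A, C, C', φ, t, hs, -, hA, z, hz, h1, h2⟩ := ht
  have hC : C.map A.subtype ≠ ⊥ := fun hb => hs.ne_bot hA
    ((Subgroup.map_eq_bot_iff_of_injective C A.subtype_injective).1 hb)
  obtain ⟨y, rfl, hy⟩ := hh.exists_preimage hC (by
    rintro _ ⟨c, hc, rfl⟩
    exact hz c hc)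
  obtain ⟨⟨_, ⟨c, hcC, rfl⟩⟩, hc⟩ := Subgroup.ne_bot_iff_exists_ne_one.1 hC
  have hc1 : (c : SurfaceGroup g) ≠ 1 := fun h1 => hc (Subtype.ext h1)
  replace hy : ∀ c ∈ C, y * (c : SurfaceGroup g) = c * y := fun c hc => hy c ⟨c, hc, rfl⟩
  have twist : ∀ w : SurfaceGroup g, (∀ c ∈ C, w * (c : SurfaceGroup g) = c * w) →
      ∃ α : SurfaceGroup g →* SurfaceGroup g, (∀ a ∈ A, α a = a) ∧ α t = w * t := by
    intro w hw
    obtain ⟨α, hα, hβ⟩ := hs.exists_hom A.subtype (w * t) (by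
      rintro ⟨c, hc⟩
      have h3 := hs.1 ⟨c, hc⟩
      simp only [Subgroup.coe_subtype] at h3 ⊢
      rw [← h3, mul_inv_rev]
      have : w⁻¹ * (c : SurfaceGroup g) * w = c := by rw [mul_assoc, ← hw c hc]; group
      calc _ = t⁻¹ * (w⁻¹ * (c : SurfaceGroup g) * w) * t := by group
        _ = _ := by rw [this])
    exact ⟨α, fun a ha => hα ⟨a, ha⟩, hβ⟩
  obtain ⟨α, hαA, hαt⟩ := twist y hy
  have hy' : ∀ c ∈ C, y⁻¹ * (c : SurfaceGroup g) = c * y⁻¹ := fun c hc => by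
    rw [inv_mul_eq_iff_eq_mul, ← mul_assoc, hy c hc, mul_inv_cancel_right]
  obtain ⟨β, hβA, hβt⟩ := twist y⁻¹ hy'
  have hαy : α y = y := fixed_of_commute hc1 (hαA c c.2) (hy c hcC)
  have hβy : β y = y := fixed_of_commute hc1 (hβA c c.2) (hy c hcC)
  have hbij : Function.Bijective α := by
    refine bijective_of_comp_eq_id (β := β) (hs.hom_ext ?_ ?_) (hs.hom_ext ?_ ?_)
    · intro a ha; simp [hαA a ha, hβA a ha]
    · simp [hαt, hβt, hαy]
    · intro a ha; simp [hαA a ha, hβA a ha]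
    · simp [hαt, hβt, hβy]
  have : h' = h.comp α := hs.hom_ext (fun a ha => by simp [h1 a ha, hαA a ha])
    (by simp [h2, hαt])
  rw [this]
  exact hh.comp_of_bijective hbij

theorem FractionalDehnTwist.admissible {h h' : SurfaceGroup g →* F}
    (ht : FractionalDehnTwist h h') (hh : IsAdmissible h) :
    IsAdmissible h' ∧ h'.range = h.range :=
  ht.elim (fun t => t.admissible hh) fun t => t.admissible hh

theorem IsAdmissible.of_twistSetoid {h h' : SurfaceGroup g →* F} (hr : twistSetoid g F h h') :
    (IsAdmissible h → IsAdmissible h' ∧ h'.range = h.range) ∧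
      (IsAdmissible h' → IsAdmissible h ∧ h.range = h'.range) := by
  change Relation.EqvGen FractionalDehnTwist h h' at hr
  induction hr with
  | rel x y hxy => exact ⟨hxy.admissible, hxy.symm.admissible⟩
  | refl x => exact ⟨fun h => ⟨h, rfl⟩, fun h => ⟨h, rfl⟩⟩
  | symm x y _ ih => exact ih.symm
  | trans x y z _ _ ih1 ih2 =>
    refine ⟨fun h => ?_, fun h => ?_⟩
    · obtain ⟨ha, hb⟩ := ih1.1 h
      exact ⟨(ih2.1 ha).1, (ih2.1 ha).2.trans hb⟩
    · obtain ⟨ha, hb⟩ := ih2.2 h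
      exact ⟨(ih1.2 ha).1, (ih1.2 ha).2.trans hb⟩

/-- Sending a class to the image of an arbitrary representative reaches every counted subgroup,
because the image does not vary within the class of an admissible representation. -/
theorem numMin'_le_numMin (g : ℕ) (x : F) : numMin' g x ≤ numMin g x := by
  refine le_trans (Set.encard_le_encard (t := (fun c : Quotient (twistSetoid g F) =>
    (Quotient.out c).range) '' _) ?_) (Set.encard_image_le _ _)
  rintro S ⟨h, hm, ha, rfl⟩
  refine ⟨Quotient.mk _ h, ⟨h, hm, fun h' hr => ((IsAdmissible.of_twistSetoid hr).1 ha).1.1, rfl⟩,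
    ?_⟩
  have hr : twistSetoid g F (Quotient.out (Quotient.mk (twistSetoid g F) h)) h :=
    Quotient.mk_out h
  exact ((IsAdmissible.of_twistSetoid hr).2 ha).2

theorem fHat'_le_fHat (g : ℕ) : fHat' F g ≤ fHat F g :=
  iSup₂_mono fun x _ => numMin'_le_numMin g x

end Twists

/-! ### Loops in a labelled graph with monotone labels -/

section Graphs

variable {X V : Type*}

/-- The edges of a graph labelled by `X`, together with their inverses. -/
def SignedEdge (T : X → V → V → Prop) : X × Bool → V → V → Prop
  | (x, true), v, w => T x v w
  | (x, false), v, w => T x w v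

/-- The word `L` can be read along a path from `v` to `w`. -/
def Reads (T : X → V → V → Prop) : List (X × Bool) → V → V → Prop
  | [], v, w => v = w
  | l :: L, v, w => ∃ u, SignedEdge T l v u ∧ Reads T L u w

/-- Edges with the same label preserve and reflect the order of the vertices. -/
def MonotoneEdges [LinearOrder V] (T : X → V → V → Prop) : Prop :=
  ∀ ⦃x v w v' w'⦄, T x v w → T x v' w' → (v < v' ↔ w < w')

/-- Every label acts as a partial injection. -/
def InjectiveEdges (T : X → V → V → Prop) : Prop :=
  ∀ ⦃x v w v' w'⦄, T x v w → T x v' w' → (v = v' ↔ w = w')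

variable {T : X → V → V → Prop}

theorem MonotoneEdges.injectiveEdges [LinearOrder V] (hT : MonotoneEdges T) :
    InjectiveEdges T := fun x v w v' w' h h' => by
  have h1 := hT h h'
  have h2 := hT h' h
  constructor <;> intro e <;> subst e
  · exact le_antisymm (not_lt.1 (h2.not.1 (lt_irrefl v))) (not_lt.1 (h1.not.1 (lt_irrefl v)))
  · exact le_antisymm (not_lt.1 (h2.not.2 (lt_irrefl w))) (not_lt.1 (h1.not.2 (lt_irrefl w)))

theorem Reads.append {L M : List (X × Bool)} {u v w : V} (h1 : Reads T L u v)
    (h2 : Reads T M v w) : Reads T (L ++ M) u w := by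
  induction L generalizing u with
  | nil => cases h1; exact h2
  | cons l L ih =>
    obtain ⟨u', hu, h⟩ := h1
    exact ⟨u', hu, ih h⟩

theorem reads_append {L M : List (X × Bool)} {u w : V} :
    Reads T (L ++ M) u w ↔ ∃ v, Reads T L u v ∧ Reads T M v w := by
  refine ⟨fun h => ?_, fun ⟨v, h1, h2⟩ => h1.append h2⟩
  induction L generalizing u with
  | nil => exact ⟨u, rfl, h⟩
  | cons l L ih =>
    obtain ⟨u', hu, h⟩ := h
    obtain ⟨v, h1, h2⟩ := ih h
    exact ⟨v, ⟨u', hu, h1⟩, h2⟩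

theorem SignedEdge.inv {x : X} {b : Bool} {v w : V} (h : SignedEdge T (x, b) v w) :
    SignedEdge T (x, !b) w v := by
  cases b <;> exact h

theorem Reads.invRev {L : List (X × Bool)} {v w : V} (h : Reads T L v w) :
    Reads T (FreeGroup.invRev L) w v := by
  induction L generalizing v with
  | nil => exact h.symm
  | cons l L ih =>
    obtain ⟨u, hu, h⟩ := h
    have := (ih h).append (M := [(l.1, !l.2)]) ⟨v, SignedEdge.inv hu, rfl⟩
    simpa [FreeGroup.invRev] using this

theorem InjectiveEdges.signedEdge (hT : InjectiveEdges T) {l : X × Bool} {v w w' : V}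
    (h : SignedEdge T l v w) (h' : SignedEdge T l v w') : w = w' := by
  obtain ⟨x, b⟩ := l
  cases b
  · exact (hT h h').2 rfl
  · exact (hT h h').1 rfl

theorem InjectiveEdges.reads_unique (hT : InjectiveEdges T) {L : List (X × Bool)} {v w w' : V}
    (h : Reads T L v w) (h' : Reads T L v w') : w = w' := by
  induction L generalizing v with
  | nil => cases h; exact h'
  | cons l L ih =>
    obtain ⟨u, hu, h⟩ := h
    obtain ⟨u', hu', h'⟩ := h'
    obtain rfl := hT.signedEdge hu hu'
    exact ih h h'

/-- A cancelling pair of letters leads back to the vertex where it started, because labels act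
injectively. -/
theorem InjectiveEdges.reads_step (hT : InjectiveEdges T) {L M : List (X × Bool)} {v w : V}
    (h : Reads T L v w) (hr : FreeGroup.Red.Step L M) : Reads T M v w := by
  obtain ⟨⟩ := hr
  rename_i L₁ L₂ x b
  obtain ⟨u, h1, u1, hu1, u2, hu2, h2⟩ := reads_append.1 h
  have : u = u2 := hT.reads_unique (L := [(x, !b)]) (v := u1) ⟨u, hu1.inv, rfl⟩ ⟨u2, hu2, rfl⟩
  subst this
  exact h1.append h2

theorem InjectiveEdges.reads_red (hT : InjectiveEdges T) {L M : List (X × Bool)} {v w : V}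
    (h : Reads T L v w) (hr : FreeGroup.Red L M) : Reads T M v w := by
  induction hr with
  | refl => exact h
  | tail _ hs ih => exact hT.reads_step ih hs

variable [LinearOrder V]

theorem MonotoneEdges.signedEdge (hT : MonotoneEdges T) {l : X × Bool} {v w v' w' : V}
    (h : SignedEdge T l v w) (h' : SignedEdge T l v' w') : v < v' ↔ w < w' := by
  obtain ⟨x, b⟩ := l
  cases b
  · exact (hT h h').symm
  · exact hT h h'

theorem MonotoneEdges.reads (hT : MonotoneEdges T) {L : List (X × Bool)} {v w v' w' : V}
    (h : Reads T L v w) (h' : Reads T L v' w') : v < v' ↔ w < w' := by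
  induction L generalizing v v' with
  | nil => cases h; cases h'; rfl
  | cons l L ih =>
    obtain ⟨u, hu, h⟩ := h
    obtain ⟨u', hu', h'⟩ := h'
    exact (hT.signedEdge hu hu').trans (ih h h')

/-- If `L` moves `v` up to `w`, then by monotonicity every further reading of `L` from a vertex
above `v` ends above `w`, so the path never returns to `v`. The same argument applies downwards. -/
theorem MonotoneEdges.reads_of_pow (hT : MonotoneEdges T) {L : List (X × Bool)} {n : ℕ}
    (hn : n ≠ 0) {v : V} (h : Reads T (List.replicate n L).flatten v v) : Reads T L v v := by
  obtain ⟨n, rfl⟩ := Nat.exists_eq_succ_of_ne_zero hn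
  obtain ⟨w, hw, h⟩ := reads_append.1 (by simpa [List.replicate_succ] using h)
  rcases lt_trichotomy v w with hlt | heq | hgt
  · have key : ∀ m u, v < u → Reads T (List.replicate m L).flatten u v → False := by
      intro m
      induction m with
      | zero =>
        rintro u hu rfl
        exact lt_irrefl _ hu
      | succ m ih =>
        intro u hu hr
        obtain ⟨u', h1, h2⟩ := reads_append.1 (by simpa [List.replicate_succ] using hr)
        exact ih u' (hlt.trans ((hT.reads hw h1).1 hu)) h2
    exact (key n w hlt h).elim
  · rwa [← heq] at hw
  · have key : ∀ m u, u < v → Reads T (List.replicate m L).flatten u v → False := by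
      intro m
      induction m with
      | zero =>
        rintro u hu rfl
        exact lt_irrefl _ hu
      | succ m ih =>
        intro u hu hr
        obtain ⟨u', h1, h2⟩ := reads_append.1 (by simpa [List.replicate_succ] using hr)
        exact ih u' (((hT.reads h1 hw).1 hu).trans hgt) h2
    exact (key n w hgt h).elim

variable [DecidableEq X]

/-- The subgroup of the elements whose reduced word is a loop at `o`. -/
def loopSubgroup (hT : MonotoneEdges T) (o : V) : Subgroup (FreeGroup X) where
  carrier := {γ | Reads T γ.toWord o o}
  one_mem' := by simp [Reads]
  mul_mem' {a b} ha hb := by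
    rw [Set.mem_ofPred_eq, FreeGroup.toWord_mul]
    exact hT.injectiveEdges.reads_red (Reads.append ha hb) FreeGroup.reduce.red
  inv_mem' {a} ha := by
    rw [Set.mem_ofPred_eq, FreeGroup.toWord_inv]
    exact Reads.invRev ha

theorem mk_mem_loopSubgroup (hT : MonotoneEdges T) {o : V} {L : List (X × Bool)}
    (h : Reads T L o o) : FreeGroup.mk L ∈ loopSubgroup hT o := by
  change Reads T (FreeGroup.mk L).toWord o o
  rw [FreeGroup.toWord_mk]
  exact hT.injectiveEdges.reads_red h FreeGroup.reduce.red

/-- The reduced word of `y ^ n` is `p cⁿ p⁻¹`, where `y = p c p⁻¹` with `c` cyclically reduced.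
Reading it at `o` makes `cⁿ` a loop at the end of `p`, hence `c` is a loop there too. -/
theorem isPrimitiveSubgroup_loopSubgroup (hT : MonotoneEdges T) (o : V) :
    IsPrimitiveSubgroup (loopSubgroup hT o) := by
  intro y n hn hy
  change Reads T (y ^ n).toWord o o at hy
  change Reads T y.toWord o o
  rw [FreeGroup.toWord_pow, FreeGroup.reduceCyclically.reduce_flatten_replicate
    FreeGroup.isReduced_toWord, if_neg hn] at hy
  obtain ⟨v, h, h3⟩ := reads_append.1 hy
  obtain ⟨u, h1, h2⟩ := reads_append.1 h
  have h3' : Reads T (FreeGroup.reduceCyclically.conjugator y.toWord) o v := by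
    simpa using h3.invRev
  obtain rfl := hT.injectiveEdges.reads_unique h1 h3'
  have := (h1.append (hT.reads_of_pow hn h2)).append h3
  rwa [FreeGroup.reduceCyclically.conj_conjugator_reduceCyclically] at this

/-- A subgroup contains the loop subgroup if it contains the discrepancies of a potential. -/
theorem loopSubgroup_le (hT : MonotoneEdges T) {o : V} {S : Subgroup (FreeGroup X)}
    (ρ : V → FreeGroup X) (ho : ρ o = 1)
    (hρ : ∀ x v w, T x v w → ρ v * FreeGroup.of x * (ρ w)⁻¹ ∈ S) : loopSubgroup hT o ≤ S := by
  -- The discrepancies telescope along a path.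
  have key : ∀ (L : List (X × Bool)) v w, Reads T L v w →
      ρ v * FreeGroup.mk L * (ρ w)⁻¹ ∈ S := by
    intro L
    induction L with
    | nil =>
      rintro v w rfl
      rw [← FreeGroup.one_eq_mk]
      simp
    | cons l L ih =>
      rintro v w ⟨u, hu, h⟩
      have h1 : ρ v * FreeGroup.mk [l] * (ρ u)⁻¹ ∈ S := by
        obtain ⟨x, b⟩ := l
        cases b
        · have := inv_mem (hρ x u v hu)
          have e : (FreeGroup.mk [(x, false)] : FreeGroup X) = (FreeGroup.of x)⁻¹ := rfl
          simpa [e, mul_assoc] using this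
        · exact hρ x v u hu
      have h2 := mul_mem h1 (ih u w h)
      have e : FreeGroup.mk (l :: L) = FreeGroup.mk [l] * FreeGroup.mk L := rfl
      rw [e]
      convert h2 using 1
      group
  intro γ hγ
  have := key γ.toWord o o hγ
  simpa [ho, FreeGroup.mk_toWord] using this

end Graphs

/-! ### Two pairs of elements of a free group of rank two with the same commutator -/

/-- For `e = false` the pair `(abab⁻¹ab, a⁻¹)` and for `e = true` the pair
`(abab⁻¹ab⁻¹, b²a⁻¹b⁻¹a⁻¹)`, as words in `a = false` and `b = true`. -/
def pairWord : Bool → Bool → List (Bool × Bool)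
  | false, false =>
    [(false, true), (true, true), (false, true), (true, false), (false, true), (true, true)]
  | false, true => [(false, false)]
  | true, false =>
    [(false, true), (true, true), (false, true), (true, false), (false, true), (true, false)]
  | true, true => [(true, true), (true, true), (false, false), (true, false), (false, false)]

/-- The edges of the core graph of the subgroup generated by a pair, with base vertex `0`. -/
def pairEdges : Bool → Bool → List (ℤ × ℤ)
  | false, false => [(-1, -2), (0, 0), (2, 1)]
  | false, true => [(-2, 0), (-1, 1), (0, 2)]
  | true, false => [(0, 1), (2, 2), (3, 4)]
  | true, true => [(0, 2), (1, 3), (2, 4)]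

/-- Paths to the vertices of the core graph from the base vertex, along a maximal tree. -/
def pairPotential (e : Bool) (k : ℤ) : List (Bool × Bool) :=
  match e with
  | false =>
    if k = 2 then [(true, true)] else
    if k = 1 then [(true, true), (false, true)] else
    if k = -1 then [(true, true), (false, true), (true, false)] else
    if k = -2 then [(true, true), (false, true), (true, false), (false, true)] else []
  | true =>
    if k = 2 then [(true, true)] else
    if k = 1 then [(false, true)] else
    if k = 3 then [(false, true), (true, true)] else
    if k = 4 then [(true, true), (true, true)] else []

/-- The labels, in terms of the pair, of the edges of the core graph outside of the tree. -/
def pairLabel (e s : Bool) (k : ℤ) : List (Bool × Bool) :=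
  match e, s with
  | false, false => if k = 0 then [(true, false)] else []
  | false, true => if k = -2 then [(true, true), (false, true)] else []
  | true, false => if k = 2 then [(true, true), (false, true)] else
    if k = 3 then [(true, false)] else []
  | true, true => []

/-- The numbering of the vertices by integers is chosen for this property, from which primitivity
follows. -/
theorem pairEdges_monotone (e s : Bool) :
    ∀ p ∈ pairEdges e s, ∀ q ∈ pairEdges e s, (p.1 < q.1 ↔ p.2 < q.2) := by
  cases e <;> cases s <;> decide

/-- The right side is the loop that runs through the tree to an edge, crosses it and returns. These
loops generate the loop subgroup, so it lies in the subgroup generated by the pair. -/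
theorem pairLabel_eq (e s : Bool) : ∀ p ∈ pairEdges e s,
    FreeGroup.lift (fun r => FreeGroup.mk (pairWord e r)) (FreeGroup.mk (pairLabel e s p.1)) =
      FreeGroup.mk (pairPotential e p.1) * FreeGroup.of s *
        (FreeGroup.mk (pairPotential e p.2))⁻¹ := by
  cases e <;> cases s <;> decide

theorem pairWord_commutator (e : Bool) :
    (FreeGroup.mk (pairWord e false) * FreeGroup.mk (pairWord e true) *
      (FreeGroup.mk (pairWord e false))⁻¹ * (FreeGroup.mk (pairWord e true))⁻¹ :
        FreeGroup Bool) =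
    FreeGroup.mk (pairWord false false) * FreeGroup.mk (pairWord false true) *
      (FreeGroup.mk (pairWord false false))⁻¹ * (FreeGroup.mk (pairWord false true))⁻¹ := by
  cases e <;> decide

/-- The core graph of a pair, with labels in the free group. -/
def PairEdge (e : Bool) (s : Bool) (v w : ℤ × FreeGroup Bool) : Prop :=
  (v.1, w.1) ∈ pairEdges e s ∧ w.2 = v.2 * FreeGroup.mk (pairLabel e s v.1)

theorem reads_pairWord (e s : Bool) :
    Reads (PairEdge e) (pairWord e s) (0, 1) (0, FreeGroup.of s) := by
  have h : ∃ c, Reads (PairEdge e) (pairWord e s) (0, 1) (0, c) ∧ c = FreeGroup.of s := by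
    let v : FreeGroup Bool := FreeGroup.of true
    let u : FreeGroup Bool := FreeGroup.of false
    cases e <;> cases s
    · exact ⟨u, ⟨(0, v⁻¹), ⟨by decide, by decide⟩, (2, v⁻¹), ⟨by decide, by decide⟩,
        (1, v⁻¹), ⟨by decide, by decide⟩, (-1, v⁻¹), ⟨by decide, by decide⟩,
        (-2, v⁻¹), ⟨by decide, by decide⟩, (0, u), ⟨by decide, by decide⟩, rfl⟩, rfl⟩
    · exact ⟨v, ⟨(0, v), ⟨by decide, by decide⟩, rfl⟩, rfl⟩
    · exact ⟨u, ⟨(1, 1), ⟨by decide, by decide⟩, (3, 1), ⟨by decide, by decide⟩,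
        (4, v⁻¹), ⟨by decide, by decide⟩, (2, v⁻¹), ⟨by decide, by decide⟩,
        (2, u), ⟨by decide, by decide⟩, (0, u), ⟨by decide, by decide⟩, rfl⟩, rfl⟩
    · exact ⟨v, ⟨(2, 1), ⟨by decide, by decide⟩, (4, 1), ⟨by decide, by decide⟩,
        (3, v), ⟨by decide, by decide⟩, (1, v), ⟨by decide, by decide⟩,
        (0, v), ⟨by decide, by decide⟩, rfl⟩, rfl⟩
  obtain ⟨c, hc, rfl⟩ := h
  exact hc

/-! ### The wedge of the core graphs -/

section Wedge

variable {g : ℕ}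

/-- The homomorphism from the free group of rank two onto the `i`-th handle. -/
def handle (i : Fin g) : FreeGroup Bool →* SurfaceGroup g := FreeGroup.map (Prod.mk i)

/-- The vertex `k` of the `i`-th core graph in the wedge of core graphs. -/
def wedgeVertex (i : Fin g) (k : ℤ) : ℤ ×ₗ ℕ := toLex (k, if k = 0 then 0 else (i : ℕ))

/-- The second coordinate merely keeps different core graphs disjoint away from the base vertex;
within one graph the order is that of the integers. -/
theorem wedgeVertex_lt_iff (i : Fin g) (k l : ℤ) :
    wedgeVertex i k < wedgeVertex i l ↔ k < l := by
  rw [wedgeVertex, wedgeVertex, Prod.Lex.toLex_lt_toLex]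
  constructor
  · rintro (h | ⟨h, h'⟩)
    · exact h
    · dsimp only at h
      subst h
      exact absurd h' (lt_irrefl _)
  · exact Or.inl

theorem wedgeVertex_injective (i : Fin g) : Function.Injective (wedgeVertex i) := fun _ _ h =>
  congrArg (fun v => (ofLex v).1) h

/-- The wedge of the core graphs of the pairs selected by `ε`. -/
def WedgeEdge (ε : Fin g → Bool) (x : Fin g × Bool) (v w : ℤ ×ₗ ℕ) : Prop :=
  ∃ p ∈ pairEdges (ε x.1) x.2, v = wedgeVertex x.1 p.1 ∧ w = wedgeVertex x.1 p.2

/-- The wedge of the core graphs with labels in the free group. -/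
def LabelledWedgeEdge (ε : Fin g → Bool) (x : Fin g × Bool)
    (v w : (ℤ ×ₗ ℕ) × SurfaceGroup g) : Prop :=
  ∃ p ∈ pairEdges (ε x.1) x.2, v.1 = wedgeVertex x.1 p.1 ∧ w.1 = wedgeVertex x.1 p.2 ∧
    w.2 = v.2 * handle x.1 (FreeGroup.mk (pairLabel (ε x.1) x.2 p.1))

theorem wedgeEdge_monotone (ε : Fin g → Bool) : MonotoneEdges (WedgeEdge ε) := by
  rintro x _ _ _ _ ⟨p, hp, rfl, rfl⟩ ⟨q, hq, rfl, rfl⟩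
  rw [wedgeVertex_lt_iff, wedgeVertex_lt_iff]
  exact pairEdges_monotone _ _ p hp q hq

/-- An edge multiplies the group coordinate on the right by an element determined by its underlying
edge, which either endpoint determines once the label is fixed. -/
theorem labelledWedgeEdge_injective (ε : Fin g → Bool) :
    InjectiveEdges (LabelledWedgeEdge ε) := by
  rintro x ⟨v, a⟩ ⟨w, b⟩ ⟨v', a'⟩ ⟨w', b'⟩ ⟨p, hp, h1, h2, h3⟩ ⟨q, hq, h4, h5, h6⟩
  dsimp only at h1 h2 h3 h4 h5 h6
  subst h1 h2 h3 h4 h5 h6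
  have key := (wedgeEdge_monotone ε).injectiveEdges (x := x) ⟨p, hp, rfl, rfl⟩ ⟨q, hq, rfl, rfl⟩
  constructor
  · intro h
    obtain ⟨hv, rfl⟩ := Prod.ext_iff.1 h
    have := wedgeVertex_injective _ hv
    exact Prod.ext (key.1 hv) (by simp [this])
  · intro h
    obtain ⟨hw, h'⟩ := Prod.ext_iff.1 h
    have hv := key.2 hw
    rw [wedgeVertex_injective _ hv] at h'
    exact Prod.ext hv (mul_right_cancel h')

theorem Reads.labelledWedge (ε : Fin g → Bool) (i : Fin g) (a : SurfaceGroup g)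
    {L : List (Bool × Bool)} {v w : ℤ × FreeGroup Bool} (h : Reads (PairEdge (ε i)) L v w) :
    Reads (LabelledWedgeEdge ε) (L.map fun l => ((i, l.1), l.2))
      (wedgeVertex i v.1, a * handle i v.2) (wedgeVertex i w.1, a * handle i w.2) := by
  induction L generalizing v with
  | nil => cases h; rfl
  | cons l L ih =>
    obtain ⟨u, hu, h⟩ := h
    refine ⟨_, ?_, ih h⟩
    obtain ⟨s, b⟩ := l
    cases b
    · exact ⟨(u.1, v.1), hu.1, rfl, rfl, by simp [hu.2, mul_assoc]⟩
    · exact ⟨(v.1, u.1), hu.1, rfl, rfl, by simp [hu.2, mul_assoc]⟩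

theorem Reads.forget_label {ε : Fin g → Bool} {L : List ((Fin g × Bool) × Bool)}
    {v w : (ℤ ×ₗ ℕ) × SurfaceGroup g} (h : Reads (LabelledWedgeEdge ε) L v w) :
    Reads (WedgeEdge ε) L v.1 w.1 := by
  induction L generalizing v with
  | nil => cases h; rfl
  | cons l L ih =>
    obtain ⟨u, hu, h⟩ := h
    refine ⟨u.1, ?_, ih h⟩
    obtain ⟨s, b⟩ := l
    cases b <;> exact hu.imp fun p hp => ⟨hp.1, hp.2.1, hp.2.2.1⟩

/-- The words of the images of the generators under the representation selected by `ε`. -/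
def wedgeWord (ε : Fin g → Bool) (x : Fin g × Bool) : List ((Fin g × Bool) × Bool) :=
  (pairWord (ε x.1) x.2).map fun l => ((x.1, l.1), l.2)

/-- The representation selected by `ε`. -/
def wedgeRep (ε : Fin g → Bool) : SurfaceGroup g →* SurfaceGroup g :=
  FreeGroup.lift fun x => FreeGroup.mk (wedgeWord ε x)

theorem wedgeRep_of (ε : Fin g → Bool) (i : Fin g) (s : Bool) :
    wedgeRep ε (FreeGroup.of (i, s)) = handle i (FreeGroup.mk (pairWord (ε i) s)) := by
  simp [wedgeRep, handle, wedgeWord]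

theorem wedgeRep_handle (ε : Fin g → Bool) (i : Fin g) (c : FreeGroup Bool) :
    wedgeRep ε (handle i c) =
      handle i (FreeGroup.lift (fun r => FreeGroup.mk (pairWord (ε i) r)) c) := by
  rw [← MonoidHom.comp_apply, ← MonoidHom.comp_apply]
  congr 1
  ext r
  have : handle i (FreeGroup.of r) = FreeGroup.of (i, r) := by simp [handle]
  simp [this, wedgeRep_of]

theorem wedgeVertex_zero (i : Fin g) : wedgeVertex i 0 = toLex ((0 : ℤ), (0 : ℕ)) := by
  simp [wedgeVertex]

theorem reads_wedgeWord (ε : Fin g → Bool) (x : Fin g × Bool) (a : SurfaceGroup g) :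
    Reads (LabelledWedgeEdge ε) (wedgeWord ε x) (toLex (0, 0), a)
      (toLex (0, 0), a * FreeGroup.of x) := by
  have := (reads_pairWord (ε x.1) x.2).labelledWedge ε x.1 a
  rw [wedgeVertex_zero, map_one, mul_one] at this
  simpa [handle, wedgeWord] using this

/-- The unreduced word of the image is a loop in the wedge whose group coordinate records `c`. -/
theorem exists_word_wedgeRep (ε : Fin g → Bool) (c : SurfaceGroup g) :
    ∃ L, wedgeRep ε c = FreeGroup.mk L ∧ ∀ a, Reads (LabelledWedgeEdge ε) L (toLex (0, 0), a)
      (toLex (0, 0), a * c) := by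
  induction c using FreeGroup.induction_on with
  | C1 => exact ⟨[], map_one _, fun a => by simp [Reads]⟩
  | of x => exact ⟨wedgeWord ε x, by simp [wedgeRep], reads_wedgeWord ε x⟩
  | inv_of x _ =>
    refine ⟨FreeGroup.invRev (wedgeWord ε x), by simp [wedgeRep], fun a => ?_⟩
    have := (reads_wedgeWord ε x (a * (FreeGroup.of x)⁻¹)).invRev
    rwa [inv_mul_cancel_right] at this
  | mul x y hx hy =>
    obtain ⟨L, hL, hL'⟩ := hx
    obtain ⟨M, hM, hM'⟩ := hy
    refine ⟨L ++ M, by rw [map_mul, hL, hM, FreeGroup.mul_mk], fun a => ?_⟩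
    have := (hL' a).append (hM' (a * x))
    rwa [mul_assoc] at this

/-- If the image of `c` is trivial, its word reduces to the empty one. Readings survive reduction,
so the empty path joins group coordinate `1` to `c`. -/
theorem wedgeRep_injective (ε : Fin g → Bool) : Function.Injective (wedgeRep ε) := by
  rw [injective_iff_map_eq_one]
  intro c hc
  obtain ⟨L, hL, hL'⟩ := exists_word_wedgeRep ε c
  have hr : FreeGroup.Red L [] := by
    have h1 : FreeGroup.reduce L = [] := by
      rw [← FreeGroup.toWord_mk, ← hL, hc, FreeGroup.toWord_one]
    rw [← h1]
    exact FreeGroup.reduce.red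
  have := (labelledWedgeEdge_injective ε).reads_red (hL' 1) hr
  simpa [Reads, eq_comm] using this

/-- Paths to the vertices of the wedge. -/
def wedgePotential (ε : Fin g → Bool) (v : ℤ ×ₗ ℕ) : SurfaceGroup g :=
  if h : (ofLex v).2 < g then
    handle ⟨(ofLex v).2, h⟩ (FreeGroup.mk (pairPotential (ε ⟨(ofLex v).2, h⟩) (ofLex v).1))
  else 1

theorem mk_pairPotential_zero (e : Bool) : FreeGroup.mk (pairPotential e 0) = 1 := by
  cases e <;> rfl

theorem wedgePotential_zero (ε : Fin g → Bool) : wedgePotential ε (toLex (0, 0)) = 1 := by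
  simp [wedgePotential, mk_pairPotential_zero]

theorem wedgePotential_vertex (ε : Fin g → Bool) (i : Fin g) (k : ℤ) :
    wedgePotential ε (wedgeVertex i k) = handle i (FreeGroup.mk (pairPotential (ε i) k)) := by
  by_cases hk : k = 0
  · subst hk
    rw [wedgeVertex_zero, wedgePotential_zero, mk_pairPotential_zero, map_one]
  · simp [wedgePotential, wedgeVertex, hk]

theorem range_wedgeRep (ε : Fin g → Bool) :
    (wedgeRep ε).range = loopSubgroup (wedgeEdge_monotone ε) (toLex (0, 0)) := by
  apply le_antisymm
  · rintro _ ⟨c, rfl⟩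
    obtain ⟨L, hL, hL'⟩ := exists_word_wedgeRep ε c
    rw [hL]
    exact mk_mem_loopSubgroup _ (hL' 1).forget_label
  · refine loopSubgroup_le _ (wedgePotential ε) (wedgePotential_zero ε) ?_
    rintro ⟨i, s⟩ _ _ ⟨p, hp, rfl, rfl⟩
    refine ⟨handle i (FreeGroup.mk (pairLabel (ε i) s p.1)), ?_⟩
    have e1 : FreeGroup.of (i, s) = handle i (FreeGroup.of s) := by simp [handle]
    rw [wedgeRep_handle, pairLabel_eq _ _ p hp, wedgePotential_vertex, wedgePotential_vertex, e1,
      map_mul, map_mul, map_inv]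

theorem isAdmissible_wedgeRep (ε : Fin g → Bool) : IsAdmissible (wedgeRep ε) := by
  refine ⟨wedgeRep_injective ε, ?_⟩
  rw [range_wedgeRep]
  exact isPrimitiveSubgroup_loopSubgroup _ _

theorem wedgeRep_boundary (ε ε' : Fin g → Bool) :
    wedgeRep ε (boundary g) = wedgeRep ε' (boundary g) := by
  have key : ∀ ε : Fin g → Bool,
      wedgeRep ε (boundary g) = wedgeRep (fun _ => false) (boundary g) := by
    intro ε
    rw [map_boundary, map_boundary]
    congr 2
    ext i
    simp only [genA, genB, wedgeRep_of, ← map_inv, ← map_mul, pairWord_commutator (ε i)]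
  rw [key ε, key ε']

/-- Membership means that an edge labelled `a_i` is a loop at the base vertex; only the core graph
of the first pair has one. -/
theorem mem_range_wedgeRep_iff (ε : Fin g → Bool) (i : Fin g) :
    FreeGroup.of (i, false) ∈ (wedgeRep ε).range ↔ ε i = false := by
  rw [range_wedgeRep]
  change Reads _ (FreeGroup.of (i, false)).toWord _ _ ↔ _
  rw [FreeGroup.toWord_of]
  constructor
  · rintro ⟨_, ⟨p, hp, h1, h2⟩, rfl⟩
    dsimp only at hp h1 h2
    rw [← wedgeVertex_zero i] at h1 h2
    replace h1 := wedgeVertex_injective _ h1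
    replace h2 := wedgeVertex_injective _ h2
    by_contra he
    rw [Bool.not_eq_false] at he
    rw [he] at hp
    obtain ⟨p1, p2⟩ := p
    dsimp only at h1 h2
    subst h1 h2
    revert hp
    decide
  · intro h
    refine ⟨_, ⟨(0, 0), ?_, (wedgeVertex_zero i).symm, (wedgeVertex_zero i).symm⟩, rfl⟩
    dsimp only
    rw [h]
    decide

theorem range_wedgeRep_injective :
    Function.Injective fun ε : Fin g → Bool => (wedgeRep ε).range := by
  intro ε ε' h
  ext i
  have h1 := mem_range_wedgeRep_iff ε i
  have h2 := mem_range_wedgeRep_iff ε' i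
  dsimp only at h
  rw [h] at h1
  have := h1.symm.trans h2
  cases h3 : ε i <;> cases h4 : ε' i <;> simp_all

/-- The common value of the representations at the boundary has genus at least `g`. -/
theorem le_of_boundary_eq_wedgeRep {n : ℕ} (ε : Fin g → Bool)
    (θ : SurfaceGroup n →* SurfaceGroup g) (hθ : θ (boundary n) = wedgeRep ε (boundary g)) :
    g ≤ n := by
  by_contra! hn
  rw [wedgeRep_boundary ε fun _ => false] at hθ
  obtain ⟨f, hf1, hf⟩ := exists_character_ne_one_comp_eq_one (X := Fin g × Bool)
    (Y := Fin n × Bool) (by simpa using hn) θ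
  refine hf1 ?_
  have hA : ∀ (k : SurfaceGroup g →* Multiplicative ℚ) i,
      (k (wedgeRep (fun _ => false) (genA i))).toAdd =
        3 * (k (genA i)).toAdd + (k (genB i)).toAdd := by
    intro k i
    have e : wedgeRep (fun _ => false) (genA i) =
        genA i * genB i * genA i * (genB i)⁻¹ * genA i * genB i := by
      rw [genA, wedgeRep_of]; rfl
    rw [e]
    simp only [map_mul, map_inv, toAdd_mul, toAdd_inv]
    ring
  have hB : ∀ (k : SurfaceGroup g →* Multiplicative ℚ) i,
      (k (wedgeRep (fun _ => false) (genB i))).toAdd = -(k (genA i)).toAdd := by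
    intro k i
    have e : wedgeRep (fun _ => false) (genB i) = (genA i)⁻¹ := by
      rw [genB, wedgeRep_of]; rfl
    rw [e, map_inv, toAdd_inv]
  have key : ∀ f' : SurfaceGroup g →* Multiplicative ℚ,
      ∑ i, ((f (genA i)).toAdd * (f' (genB i)).toAdd -
        (f (genB i)).toAdd * (f' (genA i)).toAdd) = 0 := by
    intro f'
    -- On homology the pair is `(3a + b, -a)`, of determinant one, so the form of this
    -- representation is the standard one.
    rw [← intersection_eq_zero θ (wedgeRep fun _ => false) hθ f f' hf]
    refine Finset.sum_congr rfl fun i _ => ?_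
    rw [hA, hA, hB, hB]
    ring
  refine SurfaceGroup.character_eq_one_of_gens (fun i => ?_) fun i => ?_
  · have := key (FreeGroup.lift fun x => Multiplicative.ofAdd (if x = (i, true) then 1 else 0))
    simpa [genA, genB] using this
  · have := key (FreeGroup.lift fun x => Multiplicative.ofAdd (if x = (i, false) then 1 else 0))
    simpa [genA, genB] using this

end Wedge

/-! ### Quasi-homomorphisms on a free product of two infinite cyclic groups -/

section QuasiHom

/-- The free product of two infinite cyclic groups. -/
abbrev TwoCyclic : Type := CoprodI fun _ : Bool => Multiplicative ℤ

/-- A syllable of a normal form in the free product. -/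
abbrev Syllable : Type := Σ _ : Bool, Multiplicative ℤ

/-- The syllables of a normal form. -/
def IsNormalForm (L : List Syllable) : Prop :=
  (∀ l ∈ L, l.2 ≠ 1) ∧ L.IsChain fun l l' => l.1 ≠ l'.1

/-- The element with the given syllables. -/
def syllableProd (L : List Syllable) : TwoCyclic := 
  (L.map fun l => (CoprodI.of (i := l.1) l.2 : TwoCyclic)).prod

variable {K : Type*} [Group K]

/-- The product of the values of `σ` at the exponents of the syllables of the first type. -/
def syllableValue (σ : ℤ → K) (L : List Syllable) : K :=
  (L.map fun l => if l.1 = false then σ l.2.toAdd else 1).prod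

/-- The map that replaces the syllables of the first type by the values of `σ` at their
exponents, and deletes the syllables of the second type. -/
def quasiHom (σ : ℤ → K) (x : TwoCyclic) : K :=
  syllableValue σ (CoprodI.Word.equiv x).toList

theorem quasiHom_syllableProd (σ : ℤ → K) {L : List Syllable} (hL : IsNormalForm L) :
    quasiHom σ (syllableProd L) = syllableValue σ L := by
  have : CoprodI.Word.equiv (syllableProd L) = ⟨L, hL.1, hL.2⟩ :=
    CoprodI.Word.equiv.eq_symm_apply.1 rfl
  rw [quasiHom, this]

theorem exists_normalForm (x : TwoCyclic) : ∃ L, IsNormalForm L ∧ syllableProd L = x :=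
  ⟨(CoprodI.Word.equiv x).toList, ⟨(CoprodI.Word.equiv x).ne_one, (CoprodI.Word.equiv x).chain_ne⟩,
    CoprodI.Word.equiv.symm_apply_apply x⟩

theorem quasiHom_one (σ : ℤ → K) : quasiHom σ 1 = 1 :=
  quasiHom_syllableProd σ (L := []) ⟨by simp, List.isChain_nil⟩

/-- The maps `σ` for which `quasiHom σ` is a quasi-homomorphism. -/
def IsOdd (σ : ℤ → K) : Prop := ∀ n, σ (-n) = (σ n)⁻¹

/-- Syllables cancel at the junction in inverse pairs, which odd maps respect. At most once two
syllables merge without cancelling; the exceptional exponents are the two merged ones and their sum.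
The first factor is reversed so that the induction removes its last syllable. -/
theorem exists_syllables_mul (R : List Syllable) : ∀ L : List Syllable,
    IsNormalForm R.reverse → IsNormalForm L → ∃ T : Finset ℤ, T.card ≤ 3 ∧
      ∃ N, IsNormalForm N ∧ syllableProd N = syllableProd R.reverse * syllableProd L ∧
        ∀ σ : ℤ → K, IsOdd σ → (∀ n ∈ T, σ n = 1) →
          syllableValue σ N = syllableValue σ R.reverse * syllableValue σ L := by
  induction R with
  | nil => exact fun L _ hL => ⟨∅, by simp, L, hL, by simp [syllableProd], by simp [syllableValue]⟩
  | cons l R ih =>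
    rintro (_ | ⟨l', L⟩) hR hL
    · exact ⟨∅, by simp, _, hR, by simp [syllableProd], by simp [syllableValue]⟩
    have hR' : IsNormalForm R.reverse := by
      rw [List.reverse_cons] at hR
      exact ⟨fun m hm => hR.1 m (by simp [List.mem_reverse.1 hm]), (List.isChain_append.1 hR.2).1⟩
    have hL' : IsNormalForm L := ⟨fun m hm => hL.1 m (by simp [hm]), hL.2.tail⟩
    obtain ⟨i, m⟩ := l
    obtain ⟨i', m'⟩ := l'
    by_cases hi : i = i'
    · subst hi
      by_cases hm : m * m' = 1
      · obtain ⟨T, hT, N, hN, hprod, hval⟩ := ih L hR' hL'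
        refine ⟨T, hT, N, hN, ?_, fun σ hσ h1 => ?_⟩
        · rw [hprod]
          have : (CoprodI.of (i := i) m : TwoCyclic) * CoprodI.of (i := i) m' = 1 := by
            rw [← map_mul, hm, map_one]
          simp only [syllableProd, List.reverse_cons, List.map_append, List.map_cons,
            List.map_nil, List.prod_append, List.prod_cons, List.prod_nil, mul_one]
          rw [mul_assoc, ← mul_assoc (CoprodI.of (M := fun _ : Bool => Multiplicative ℤ) (i := i) m),
            this, one_mul]
        · rw [hval σ hσ h1]
          have hm' : m'.toAdd = -m.toAdd := by
            rw [eq_inv_of_mul_eq_one_right hm]; rfl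
          simp only [syllableValue, List.reverse_cons, List.map_append, List.map_cons,
            List.map_nil, List.prod_append, List.prod_cons, List.prod_nil, mul_one, hm', hσ m.toAdd]
          split_ifs <;> simp [mul_assoc]
      · refine ⟨{m.toAdd, m'.toAdd, (m * m').toAdd}, Finset.card_le_three,
          R.reverse ++ ⟨i, m * m'⟩ :: L, ⟨?_, ?_⟩, ?_, fun σ _ h1 => ?_⟩
        · intro p hp
          rcases List.mem_append.1 hp with hp | hp
          · exact hR'.1 p hp
          · rcases List.mem_cons.1 hp with rfl | hp
            · exact hm
            · exact hL'.1 p hp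
        · have h1 := hR.2
          have h2 := hL.2
          rw [List.reverse_cons] at h1
          rw [List.isChain_append] at h1 ⊢
          refine ⟨h1.1, ?_, ?_⟩
          · rw [List.isChain_cons] at h2 ⊢
            exact h2
          · simpa using h1.2.2
        · simp [syllableProd, mul_assoc]
        · have e1 := h1 m.toAdd (by simp)
          have e2 := h1 m'.toAdd (by simp)
          have e3 := h1 (m * m').toAdd (by simp)
          rw [toAdd_mul] at e3
          simp [syllableValue, e1, e2, e3]
    · refine ⟨∅, by simp, (⟨i, m⟩ :: R).reverse ++ ⟨i', m'⟩ :: L, ⟨?_, ?_⟩, ?_, fun σ _ _ => ?_⟩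
      · intro p hp
        rcases List.mem_append.1 hp with hp | hp
        · exact hR.1 p hp
        · exact hL.1 p hp
      · rw [List.isChain_append]
        exact ⟨hR.2, hL.2, by simpa using hi⟩
      · simp [syllableProd, mul_assoc]
      · simp [syllableValue, mul_assoc]

theorem exists_quasiHom_mul (x y : TwoCyclic) : ∃ T : Finset ℤ, T.card ≤ 3 ∧
    ∀ σ : ℤ → K, IsOdd σ → (∀ n ∈ T, σ n = 1) →
      quasiHom σ (x * y) = quasiHom σ x * quasiHom σ y := by
  obtain ⟨L, hL, rfl⟩ := exists_normalForm x
  obtain ⟨M, hM, rfl⟩ := exists_normalForm y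
  obtain ⟨T, hT, N, hN, hprod, hval⟩ :=
    exists_syllables_mul (K := K) L.reverse M (by simpa using hL) hM
  rw [List.reverse_reverse] at hprod hval
  refine ⟨T, hT, fun σ hσ h1 => ?_⟩
  rw [← hprod, quasiHom_syllableProd σ hN, quasiHom_syllableProd σ hL,
    quasiHom_syllableProd σ hM, hval σ hσ h1]

/-- Up to a number of exponents that does not depend on `θ`, the map `quasiHom σ ∘ θ` is a
homomorphism at `z`. -/
theorem exists_quasiHom_eq_lift {Y : Type*} (z : FreeGroup Y) : ∃ N : ℕ,
    ∀ θ : FreeGroup Y →* TwoCyclic, ∃ T : Finset ℤ, T.card ≤ N ∧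
      ∀ σ : ℤ → K, IsOdd σ → (∀ n ∈ T, σ n = 1) →
        quasiHom σ (θ z) = FreeGroup.lift (fun y => quasiHom σ (θ (FreeGroup.of y))) z := by
  induction z using FreeGroup.induction_on with
  | C1 => exact ⟨0, fun θ => ⟨∅, by simp, fun σ _ _ => by simp [quasiHom_one]⟩⟩
  | of y => exact ⟨0, fun θ => ⟨∅, by simp, fun σ _ _ => by simp⟩⟩
  | inv_of y _ =>
    refine ⟨3, fun θ => ?_⟩
    -- Multiplicativity for the product `x⁻¹ x = 1` determines the value at `x⁻¹`.
    obtain ⟨T, hT, h⟩ := exists_quasiHom_mul (K := K) (θ (FreeGroup.of y))⁻¹ (θ (FreeGroup.of y))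
    refine ⟨T, hT, fun σ hσ h1 => ?_⟩
    have := h σ hσ h1
    rw [inv_mul_cancel, quasiHom_one] at this
    rw [map_inv, map_inv, FreeGroup.lift_apply_of]
    exact eq_inv_of_mul_eq_one_left this.symm
  | mul z z' hz hz' =>
    obtain ⟨N, hN⟩ := hz
    obtain ⟨N', hN'⟩ := hz'
    refine ⟨N + N' + 3, fun θ => ?_⟩
    obtain ⟨T, hT, h⟩ := hN θ
    obtain ⟨T', hT', h'⟩ := hN' θ
    obtain ⟨T'', hT'', h''⟩ := exists_quasiHom_mul (K := K) (θ z) (θ z')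
    refine ⟨T ∪ T' ∪ T'', ?_, fun σ hσ h1 => ?_⟩
    · have e1 := Finset.card_union_le (T ∪ T') T''
      have e2 := Finset.card_union_le T T'
      omega
    · rw [map_mul, map_mul, h'' σ hσ fun n hn => h1 n (by simp [hn]),
        h σ hσ fun n hn => h1 n (by simp [hn]), h' σ hσ fun n hn => h1 n (by simp [hn])]

end QuasiHom

/-! ### Words with many different exponents -/

section SpreadWords

/-- The exponents of the `k`-th word. -/
def spreadExponent (k j : ℕ) : ℤ := (Nat.pair k j : ℤ) + 2

theorem spreadExponent_inj {k j k' j' : ℕ} (h : spreadExponent k j = spreadExponent k' j') :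
    k = k' ∧ j = j' := by
  rw [spreadExponent, spreadExponent, add_left_inj, Nat.cast_inj] at h
  exact Nat.pair_eq_pair.1 h

theorem two_le_spreadExponent (k j : ℕ) : 2 ≤ spreadExponent k j := by
  rw [spreadExponent]; omega

/-- The syllables `aⁿ b a b⁻¹`. -/
def spreadBlock (n : ℤ) : List Syllable :=
  [⟨false, Multiplicative.ofAdd n⟩, ⟨true, Multiplicative.ofAdd 1⟩,
    ⟨false, Multiplicative.ofAdd 1⟩, ⟨true, Multiplicative.ofAdd (-1)⟩]

/-- The syllables `bᵏ⁺² a b⁻ᵏ⁻² · ∏ⱼ aⁿ⁽ʲ⁾ b a b⁻¹` of the `k`-th word, with `m` exponents. -/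
def spreadList (k m : ℕ) : List Syllable :=
  ⟨true, Multiplicative.ofAdd ((k : ℤ) + 2)⟩ :: ⟨false, Multiplicative.ofAdd 1⟩ ::
    ⟨true, Multiplicative.ofAdd (-((k : ℤ) + 2))⟩ ::
      (List.range m).flatMap fun j => spreadBlock (spreadExponent k j)

theorem isChain_spreadBlocks (f : ℕ → ℤ) (l : List ℕ) : ∀ c : Multiplicative ℤ,
    List.IsChain (fun l l' : Syllable => l.1 ≠ l'.1)
      (⟨true, c⟩ :: l.flatMap fun j => spreadBlock (f j)) := by
  induction l with
  | nil => simp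
  | cons j l ih =>
    intro c
    have := ih (Multiplicative.ofAdd (-1))
    simpa [spreadBlock] using this

theorem isNormalForm_spreadList (k m : ℕ) : IsNormalForm (spreadList k m) := by
  constructor
  · have hne : ∀ n : ℤ, n ≠ 0 → Multiplicative.ofAdd n ≠ 1 := fun n hn h =>
      hn (congrArg Multiplicative.toAdd h)
    intro l hl
    simp only [spreadList, List.mem_cons, List.mem_flatMap, spreadBlock] at hl
    have h2 := two_le_spreadExponent k
    rcases hl with rfl | rfl | rfl | ⟨j, -, rfl | rfl | rfl | rfl | hl⟩
    · exact hne _ (by omega)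
    · exact hne _ (by omega)
    · exact hne _ (by omega)
    · exact hne _ (by have := h2 j; omega)
    · exact hne _ (by omega)
    · exact hne _ (by omega)
    · exact hne _ (by omega)
    · simp at hl
  · have := isChain_spreadBlocks (spreadExponent k) (List.range m)
      (Multiplicative.ofAdd (-((k : ℤ) + 2)))
    simpa [spreadList] using this

/-- All other syllables of the first type have exponent `1`, which `σ` kills. -/
theorem syllableValue_spreadList {K : Type*} [Group K] (σ : ℤ → K) (h1 : σ 1 = 1) (k m : ℕ) :
    syllableValue σ (spreadList k m) =
      ((List.range m).map fun j => σ (spreadExponent k j)).prod := by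
  have : ∀ l : List ℕ, syllableValue σ (l.flatMap fun j => spreadBlock (spreadExponent k j)) =
      (l.map fun j => σ (spreadExponent k j)).prod := by
    intro l
    induction l with
    | nil => simp [syllableValue]
    | cons j l ih =>
      rw [List.map_cons, List.prod_cons, ← ih]
      simp [syllableValue, spreadBlock, h1]
  rw [← this]
  simp [syllableValue, spreadList, h1]

variable {X : Type*}

/-- The homomorphism that sends the generators to words with `m` different exponents each. -/
noncomputable def spreadHom (idx : X → ℕ) (m : ℕ) : FreeGroup X →* TwoCyclic :=
  FreeGroup.lift fun x => syllableProd (spreadList (idx x) m)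

open Classical in
/-- The map that sends one of the exponents of the `x`-th word to `x`, for every `x`. -/
noncomputable def detect (idx : X → ℕ) (J : X → ℕ) (n : ℤ) : FreeGroup X :=
  if h : ∃ x, n = spreadExponent (idx x) (J x) then FreeGroup.of h.choose else
  if h : ∃ x, -n = spreadExponent (idx x) (J x) then (FreeGroup.of h.choose)⁻¹ else 1

theorem detect_isOdd (idx : X → ℕ) (J : X → ℕ) : IsOdd (detect idx J) := by
  intro n
  have hpos : ∀ n : ℤ, (∃ x, n = spreadExponent (idx x) (J x)) →
      ¬ ∃ x, -n = spreadExponent (idx x) (J x) := by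
    rintro n ⟨x, hx⟩ ⟨y, hy⟩
    have := two_le_spreadExponent (idx x) (J x)
    have := two_le_spreadExponent (idx y) (J y)
    omega
  have key : ∀ m n : ℤ, m = -n → n = -m → detect idx J m = (detect idx J n)⁻¹ := by
    intro m n h1 h2
    have hm := hpos m
    rw [detect, detect, ← h1, ← h2]
    rw [← h2] at hm
    by_cases h : ∃ x, m = spreadExponent (idx x) (J x)
    · rw [dif_pos h, dif_neg (hm h), dif_pos h, inv_inv]
    · by_cases h' : ∃ x, n = spreadExponent (idx x) (J x)
      · rw [dif_neg h, dif_pos h', dif_pos h']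
      · rw [dif_neg h, dif_neg h', dif_neg h', dif_neg h, inv_one]
  exact key _ _ rfl (neg_neg n).symm

theorem detect_eq_one {idx : X → ℕ} {J : X → ℕ} {n : ℤ}
    (h : ∀ x, n ≠ spreadExponent (idx x) (J x) ∧ -n ≠ spreadExponent (idx x) (J x)) :
    detect idx J n = 1 := by
  rw [detect, dif_neg fun ⟨x, hx⟩ => (h x).1 hx, dif_neg fun ⟨x, hx⟩ => (h x).2 hx]

theorem detect_spreadExponent {idx : X → ℕ} (hidx : Function.Injective idx) (J : X → ℕ) (x : X)
    (j : ℕ) : detect idx J (spreadExponent (idx x) j) = if j = J x then FreeGroup.of x else 1 := by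
  have h2 := two_le_spreadExponent (idx x) j
  split_ifs with hj
  · have h : ∃ y, spreadExponent (idx x) j = spreadExponent (idx y) (J y) := ⟨x, by rw [hj]⟩
    rw [detect, dif_pos h]
    exact congrArg _ (hidx (spreadExponent_inj h.choose_spec).1).symm
  · refine detect_eq_one fun y => ⟨fun h => ?_, fun h => ?_⟩
    · obtain ⟨h3, h4⟩ := spreadExponent_inj h
      rw [← hidx h3] at h4
      exact hj h4
    · have := two_le_spreadExponent (idx y) (J y)
      omega

theorem quasiHom_spreadHom {idx : X → ℕ} (hidx : Function.Injective idx) {J : X → ℕ} {m : ℕ}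
    (hJ : ∀ x, J x < m) (x : X) :
    quasiHom (detect idx J) (spreadHom idx m (FreeGroup.of x)) = FreeGroup.of x := by
  rw [spreadHom, FreeGroup.lift_apply_of, quasiHom_syllableProd _ (isNormalForm_spreadList _ _),
    syllableValue_spreadList]
  · simp_rw [detect_spreadExponent hidx]
    have : ∀ m, ((List.range m).map fun j => if j = J x then FreeGroup.of x else 1).prod =
        if J x < m then FreeGroup.of x else 1 := by
      intro m
      induction m with
      | zero => simp
      | succ m ih =>
        rw [List.range_succ, List.map_append, List.prod_append, ih]
        rcases lt_trichotomy (J x) m with h | h | h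
        · simp [h, h.ne', h.trans (Nat.lt_succ_self m)]
        · simp [h]
        · simp [h.ne, not_lt.2 h.le, not_lt.2 (Nat.succ_le_of_lt h)]
    rw [this, if_pos (hJ x)]
  · refine detect_eq_one fun y => ?_
    have := two_le_spreadExponent (idx y) (J y)
    omega

/-- For a large number of exponents, `spreadHom` does not decrease the genus of `y`. -/
theorem exists_spreadHom_genus {idx : X → ℕ} (hidx : Function.Injective idx) (y : FreeGroup X)
    (g : ℕ) : ∃ m, ∀ n < g, ∀ θ : SurfaceGroup n →* TwoCyclic,
      θ (boundary n) = spreadHom idx m y →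
        ∃ θ' : SurfaceGroup n →* FreeGroup X, θ' (boundary n) = y := by
  obtain ⟨N, hN⟩ := exists_quasiHom_eq_lift (K := FreeGroup X) y
  choose N' hN' using fun n => exists_quasiHom_eq_lift (K := FreeGroup X) (boundary n)
  -- At most `N + N' n` exponents are exceptional and their negatives must be avoided too. The sum
  -- bounds all `N' n` with `n < g` at once, so one `m` leaves every generator a free exponent.
  refine ⟨2 * (N + ∑ n ∈ Finset.range g, N' n) + 1, fun n hn θ hθ => ?_⟩
  set m := 2 * (N + ∑ n ∈ Finset.range g, N' n) + 1 with hm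
  obtain ⟨T, hT, h⟩ := hN (spreadHom idx m)
  obtain ⟨T', hT', h'⟩ := hN' n θ
  have hle : N' n ≤ ∑ n ∈ Finset.range g, N' n :=
    Finset.single_le_sum (f := N') (fun _ _ => Nat.zero_le _) (Finset.mem_range.2 hn)
  let U : Finset ℤ := (T ∪ T') ∪ (T ∪ T').image Neg.neg
  have hU : U.card < m := by
    have e1 := Finset.card_union_le (T ∪ T') ((T ∪ T').image Neg.neg)
    have e2 : ((T ∪ T').image Neg.neg).card ≤ (T ∪ T').card := Finset.card_image_le
    have e3 := Finset.card_union_le T T'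
    change ((T ∪ T') ∪ (T ∪ T').image Neg.neg).card < m
    omega
  have hex : ∀ x, ∃ j < m, spreadExponent (idx x) j ∉ U := by
    intro x
    have hc : ((Finset.range m).image (spreadExponent (idx x))).card = m := by
      rw [Finset.card_image_of_injective _ fun _ _ h => (spreadExponent_inj h).2,
        Finset.card_range]
    obtain ⟨n, hn, hnU⟩ := Finset.exists_mem_notMem_of_card_lt_card (hU.trans_eq hc.symm)
    obtain ⟨j, hj, rfl⟩ := Finset.mem_image.1 hn
    exact ⟨j, Finset.mem_range.1 hj, hnU⟩
  choose J hJ hJU using hex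
  have hσ : ∀ n ∈ T ∪ T', detect idx J n = 1 := by
    intro n hn
    refine detect_eq_one fun x => ⟨fun e => hJU x ?_, fun e => hJU x ?_⟩
    · rw [← e]; exact Finset.mem_union_left _ hn
    · rw [← e]; exact Finset.mem_union_right _ (Finset.mem_image_of_mem _ hn)
  have e1 := h (detect idx J) (detect_isOdd _ _) fun n hn => hσ n (Finset.mem_union_left _ hn)
  have e2 := h' (detect idx J) (detect_isOdd _ _) fun n hn => hσ n (Finset.mem_union_right _ hn)
  -- The new representation sends each generator to the value of the quasi-homomorphism at its image
  -- under `θ`.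
  refine ⟨_, e2.symm.trans ?_⟩
  rw [hθ, e1]
  simp_rw [quasiHom_spreadHom hidx hJ]
  exact DFunLike.congr_fun (FreeGroup.lift_of_eq_id X) y

end SpreadWords

/-! ### Primitive subgroups and wreath products -/

section Wreath

variable {K A F : Type*} [Group K] [Group A] [Group F]

/-- The element `w` of the wreath product lies in the base group and has value `k` at `1`. -/
def IsBaseValue (w : K ≀ᵣ A) (k : K) : Prop := w.right = 1 ∧ w.left 1 = k

theorem IsBaseValue.one : IsBaseValue (1 : K ≀ᵣ A) 1 := ⟨rfl, rfl⟩

theorem IsBaseValue.mul {w w' : K ≀ᵣ A} {k k' : K} (h : IsBaseValue w k)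
    (h' : IsBaseValue w' k') : IsBaseValue (w * w') (k * k') :=
  ⟨by simp [h.1, h'.1], by simp [h.1, h.2, h'.2]⟩

theorem IsBaseValue.inv {w : K ≀ᵣ A} {k : K} (h : IsBaseValue w k) : IsBaseValue w⁻¹ k⁻¹ :=
  ⟨by simp [h.1], by simp [h.1, h.2]⟩

theorem IsBaseValue.pow {w : K ≀ᵣ A} {k : K} (h : IsBaseValue w k) (n : ℕ) :
    IsBaseValue (w ^ n) (k ^ n) := by
  induction n with
  | zero => simpa using IsBaseValue.one
  | succ n ih => rw [pow_succ, pow_succ]; exact ih.mul h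

theorem IsBaseValue.zpow {w : K ≀ᵣ A} {k : K} (h : IsBaseValue w k) (n : ℤ) :
    IsBaseValue (w ^ n) (k ^ n) := by
  cases n with
  | ofNat n => simpa using h.pow n
  | negSucc n => rw [zpow_negSucc, zpow_negSucc]; exact (h.pow _).inv

theorem isBaseValue_conj (f : A → K) (q : A) :
    IsBaseValue (RegularWreathProduct.inl q * ⟨f, 1⟩ * RegularWreathProduct.inl q⁻¹ : K ≀ᵣ A)
      (f q⁻¹) :=
  ⟨by simp, by simp⟩

variable {e : K →* F} {Ψ : F →* K ≀ᵣ A}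

theorem injective_of_isBaseValue (h : ∀ k, IsBaseValue (Ψ (e k)) k) : Function.Injective e :=
  fun k l hkl => by rw [← (h k).2, ← (h l).2, hkl]

/-- If `yⁿ = e(k)`, then `Ψ y` lies in the base group because `A` is torsion-free. Its value at `1`
is an `n`-th root of `k`, hence in `S`, and `e` maps it to `y` by uniqueness of roots. -/
theorem IsPrimitiveSubgroup.map_of_isBaseValue [IsMulTorsionFree F] [IsMulTorsionFree A]
    (h : ∀ k, IsBaseValue (Ψ (e k)) k) {S : Subgroup K} (hS : IsPrimitiveSubgroup S) :
    IsPrimitiveSubgroup (S.map e) := by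
  rintro y n hn ⟨k, hk, hky⟩
  have h1 : (Ψ y).right = 1 := by
    refine pow_left_injective hn ?_
    have := congrArg RegularWreathProduct.rightHom (congrArg Ψ hky)
    rw [map_pow, map_pow] at this
    simpa [(h k).1] using this.symm
  have h2 := IsBaseValue.pow (w := Ψ y) ⟨h1, rfl⟩ n
  have h3 : ((Ψ y).left 1) ^ n = k := by
    rw [← h2.2, ← map_pow, ← hky, (h k).2]
  refine ⟨(Ψ y).left 1, hS _ n hn (by rwa [h3]), pow_left_injective hn ?_⟩
  simp only
  rw [← map_pow, h3, hky]

end Wreath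

/-! ### Embedding a countably generated free group in any nonabelian free group. -/

section Embedding

variable {X : Type*}

open Classical in
/-- The value of `bᵏ a b⁻ᵏ`, which is `x` if the index of `x` is `k - 2`. -/
noncomputable def levelValue (idx : X → ℕ) (k : ℤ) : FreeGroup X :=
  if h : ∃ x, k = (idx x : ℤ) + 2 then FreeGroup.of h.choose else 1

theorem levelValue_of_lt (idx : X → ℕ) {k : ℤ} (hk : k < 2) : levelValue idx k = 1 := by
  rw [levelValue, dif_neg]
  rintro ⟨x, rfl⟩
  omega

theorem levelValue_idx {idx : X → ℕ} (hidx : Function.Injective idx) (x : X) :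
    levelValue idx ((idx x : ℤ) + 2) = FreeGroup.of x := by
  have h : ∃ y, (idx x : ℤ) + 2 = (idx y : ℤ) + 2 := ⟨x, rfl⟩
  rw [levelValue, dif_pos h]
  refine congrArg _ (hidx ?_).symm
  have := h.choose_spec
  omega

/-- The homomorphism to a wreath product under which `bᵏ a b⁻ᵏ` has the value `levelValue idx k`
at `1`. -/
noncomputable def wreathHom (idx : X → ℕ) : TwoCyclic →* FreeGroup X ≀ᵣ Multiplicative ℤ :=
  CoprodI.lift fun i => zpowersHom _ (if i then RegularWreathProduct.inl (Multiplicative.ofAdd 1)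
    else ⟨fun q => levelValue idx (-q.toAdd), 1⟩)

theorem isBaseValue_wreathHom_conj (idx : X → ℕ) (k n : ℤ) :
    IsBaseValue (wreathHom idx (syllableProd [⟨true, Multiplicative.ofAdd k⟩,
      ⟨false, Multiplicative.ofAdd n⟩, ⟨true, Multiplicative.ofAdd (-k)⟩]))
        (levelValue idx k ^ n) := by
  have hb : ∀ k : ℤ, wreathHom idx (CoprodI.of (i := true) (Multiplicative.ofAdd k)) =
      RegularWreathProduct.inl (Multiplicative.ofAdd k) := by
    intro k
    simp [wreathHom, zpowersHom_apply, ← map_zpow, ← ofAdd_zsmul]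
  have ha : wreathHom idx (CoprodI.of (i := false) (Multiplicative.ofAdd n)) =
      ⟨fun q => levelValue idx (-q.toAdd), 1⟩ ^ n := by
    simp [wreathHom, zpowersHom_apply]
  have := (isBaseValue_conj (fun q : Multiplicative ℤ => levelValue idx (-q.toAdd))
    (Multiplicative.ofAdd k)).zpow n
  rw [map_inv, conj_zpow, toAdd_inv, toAdd_ofAdd, neg_neg] at this
  simpa [syllableProd, hb, ha, mul_assoc, ofAdd_neg] using this

theorem syllableProd_append (L M : List Syllable) :
    syllableProd (L ++ M) = syllableProd L * syllableProd M := by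
  simp [syllableProd]

/-- A block is a product of conjugates of powers of `a` by `b⁰` and `b¹`. These levels carry the
value `1`, as the generators occupy levels from `2` on. -/
theorem isBaseValue_wreathHom_spreadBlocks (idx : X → ℕ) (f : ℕ → ℤ) (l : List ℕ) :
    IsBaseValue (wreathHom idx (syllableProd (l.flatMap fun j => spreadBlock (f j)))) 1 := by
  induction l with
  | nil => simpa [syllableProd] using IsBaseValue.one
  | cons j l ih =>
    have h1 := isBaseValue_wreathHom_conj idx 0 (f j)
    have h2 := isBaseValue_wreathHom_conj idx 1 1
    rw [levelValue_of_lt idx (by norm_num), one_zpow] at h1 h2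
    have := (h1.mul h2).mul ih
    rw [← map_mul, ← map_mul] at this
    simpa [syllableProd, spreadBlock, mul_assoc] using this

/-- The prefix `bᵏ⁺² a b⁻ᵏ⁻²` of each word contributes the generator of index `k`, and the blocks
contribute nothing. -/
theorem isBaseValue_wreathHom_spreadHom {idx : X → ℕ} (hidx : Function.Injective idx) (m : ℕ)
    (c : FreeGroup X) : IsBaseValue (wreathHom idx (spreadHom idx m c)) c := by
  have hof : ∀ x, IsBaseValue (wreathHom idx (spreadHom idx m (FreeGroup.of x)))
      (FreeGroup.of x) := by
    intro x
    have h1 := isBaseValue_wreathHom_conj idx ((idx x : ℤ) + 2) 1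
    rw [levelValue_idx hidx, zpow_one] at h1
    have := h1.mul (isBaseValue_wreathHom_spreadBlocks idx (spreadExponent (idx x)) (List.range m))
    rw [← map_mul, ← syllableProd_append, mul_one] at this
    rw [spreadHom, FreeGroup.lift_apply_of]
    exact this
  induction c using FreeGroup.induction_on with
  | C1 => simpa using IsBaseValue.one
  | of x => exact hof x
  | inv_of x _ => rw [map_inv, map_inv]; exact (hof x).inv
  | mul x y hx hy => rw [map_mul, map_mul]; exact hx.mul hy

variable {F : Type*} [Group F] [IsFreeGroup F]

/-- The free product of two infinite cyclic groups is a retract of every nonabelian free group. -/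
theorem exists_retract_twoCyclic (hF : ∃ u v : F, u * v ≠ v * u) :
    ∃ (s : TwoCyclic →* F) (r : F →* TwoCyclic), ∀ x, r (s x) = x := by
  classical
  obtain ⟨p, q, hpq⟩ : ∃ p q : IsFreeGroup.Generators F, p ≠ q := by
    by_contra! hsub
    have : Subsingleton (IsFreeGroup.Generators F) := ⟨hsub⟩
    obtain ⟨u, v, huv⟩ := hF
    have hc : IsCyclic (FreeGroup (IsFreeGroup.Generators F)) :=
      isCyclic_freeGroup_of_subsingleton
    obtain ⟨w, hw⟩ := hc.exists_generator
    obtain ⟨i, hi⟩ := hw (IsFreeGroup.toFreeGroup F u)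
    obtain ⟨j, hj⟩ := hw (IsFreeGroup.toFreeGroup F v)
    refine huv ((IsFreeGroup.toFreeGroup F).injective ?_)
    rw [map_mul, map_mul, ← hi, ← hj]
    exact zpow_mul_comm w i j
  let s : TwoCyclic →* F := CoprodI.lift fun i => zpowersHom F (IsFreeGroup.of (cond i q p))
  let r : F →* TwoCyclic := IsFreeGroup.lift fun i =>
    if i = p then CoprodI.of (i := false) (Multiplicative.ofAdd 1) else
    if i = q then CoprodI.of (i := true) (Multiplicative.ofAdd 1) else 1
  have : r.comp s = MonoidHom.id _ := by
    refine CoprodI.ext_hom _ _ fun i => ?_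
    ext
    cases i
    · simp [r, s, zpowersHom_apply]
    · simp [r, s, zpowersHom_apply, hpq.symm]
  exact ⟨s, r, DFunLike.congr_fun this⟩

/-- A free group of finite rank embeds in every nonabelian free group in such a way that
primitive subgroups stay primitive and the genus of a given element does not drop below `g`. -/
theorem exists_embedding (hF : ∃ u v : F, u * v ≠ v * u) [Countable X] (y : FreeGroup X) (g : ℕ) :
    ∃ e : FreeGroup X →* F, Function.Injective e ∧
      (∀ S : Subgroup (FreeGroup X), IsPrimitiveSubgroup S → IsPrimitiveSubgroup (S.map e)) ∧
      ∀ n < g, ∀ θ : SurfaceGroup n →* F, θ (boundary n) = e y →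
        ∃ θ' : SurfaceGroup n →* FreeGroup X, θ' (boundary n) = y := by
  obtain ⟨idx, hidx⟩ := exists_injective_nat X
  obtain ⟨s, r, hrs⟩ := exists_retract_twoCyclic hF
  obtain ⟨m, hm⟩ := exists_spreadHom_genus hidx y g
  have key : ∀ k, IsBaseValue ((wreathHom idx).comp r ((s.comp (spreadHom idx m)) k)) k := by
    intro k
    simpa [hrs] using isBaseValue_wreathHom_spreadHom hidx m k
  refine ⟨s.comp (spreadHom idx m), injective_of_isBaseValue key,
    fun S hS => hS.map_of_isBaseValue key, fun n hn θ hθ => hm n hn (r.comp θ) ?_⟩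
  simp [hθ, hrs]

theorem two_pow_le_fHat' (hF : ∃ u v : F, u * v ≠ v * u) (g : ℕ) : (2 : ℕ∞) ^ g ≤ fHat' F g := by
  let ε₀ : Fin g → Bool := fun _ => false
  obtain ⟨e, he, hprim, hgenus⟩ := exists_embedding hF (wedgeRep ε₀ (boundary g)) g
  set x := e (wedgeRep ε₀ (boundary g)) with hx
  have hrep : ∀ ε : Fin g → Bool, Represents (e.comp (wedgeRep ε)) x := fun ε => by
    rw [Represents, MonoidHom.comp_apply, wedgeRep_boundary ε ε₀]
  have hg : HasAlgebraicGenus x g := by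
    refine ⟨⟨_, hrep ε₀⟩, ?_⟩
    rintro n ⟨θ, hθ⟩
    by_contra! hn
    obtain ⟨θ', hθ'⟩ := hgenus n hn θ hθ
    exact hn.not_ge (le_of_boundary_eq_wedgeRep ε₀ θ' hθ')
  refine le_trans ?_ (le_iSup₂_of_le x hg le_rfl)
  have hinj : Function.Injective fun ε : Fin g → Bool => (e.comp (wedgeRep ε)).range := by
    intro ε ε' h
    simp only [MonoidHom.range_comp] at h
    exact range_wedgeRep_injective (Subgroup.map_injective he h)
  have hcard : (Set.range fun ε : Fin g → Bool => (e.comp (wedgeRep ε)).range).encard =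
      (2 : ℕ∞) ^ g := by
    rw [← Set.image_univ, hinj.encard_image, Set.encard_univ]
    simp
  rw [← hcard]
  refine Set.encard_le_encard ?_
  rintro _ ⟨ε, rfl⟩
  refine ⟨e.comp (wedgeRep ε), ⟨hrep ε, hg⟩, ⟨he.comp (wedgeRep_injective ε), ?_⟩, rfl⟩
  rw [MonoidHom.range_comp]
  exact hprim _ (isAdmissible_wedgeRep ε).2

end Embedding

end SurfaceRep

theorem mainTheorem4 {F : Type*} [Group F] [IsFreeGroup F] [Group.FG F]
    (hF : ∃ u v : F, u * v ≠ v * u) (g : ℕ) :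
    SurfaceRep.fHat F g ≤ SurfaceRep.selaNumber F g ∧
      SurfaceRep.fHat' F g ≤ SurfaceRep.fHat F g ∧
      (2 : ℕ∞) ^ g ≤ SurfaceRep.fHat' F g :=
  ⟨SurfaceRep.fHat_le_selaNumber F g, SurfaceRep.fHat'_le_fHat g,
    SurfaceRep.two_pow_le_fHat' hF g⟩
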